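/- **Setting.** Let $\Lambda$ be a finite graph, with $\mathbb{C}^d$ attached to each site, $\mathcal H=(\mathbb{C}^d)^{\otimes\Lambda}$, and $\|\cdot\|$ the operator norm on $\mathcal B(\mathcal H)$. An operator is supported in $S\subset\Lambda$ if it has the form $O_S\otimes 1_{S^c}$. For $\alpha=1,\dots,q$ let $N^{(\alpha)}=\sum_{S\subset\Lambda}N^{\alpha}_S$, where the $N^\alpha_S$ are Hermitian, supported in $S$, mutually commuting (for all $\alpha,\alpha',S,S'$), have integer spectrum, vanish if $\mathrm{diam}(S)>R$, and satisfy $\sup_{i}\sum_{S\ni i}\|N^\alpha_S\|\le\gamma$. An operator is *strongly supported* in $S$ if it is supported in $S$ and commutes with $N^\alpha_{S'}$ for all $\alpha$ and all $S'\not\subset S$. A *potential* is a family $G=(G_S)$ indexed by the nonempty connected sets $S\subset\Lambda$, with $G_S$ strongly supported in $S$; the operator $\sum_S G_S$ is also denoted by $G$. Its local norms are $\|G\|_\kappa=\max_{i\in\Lambda}\sum_{S\ni i}e^{\kappa|S|}\|G_S\|$. Let $H=H^0+gW$ with $g>0$ and $H^0=\mathbf J\cdot\mathbf N=\sum_{\alpha}J_\alpha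 N^{(\alpha)}$, $0\ne\mathbf J\in\mathbb{R}^q$, where $W$ is a potential with Hermitian terms and $\|gW\|_{\kappa_0}\le g$ for some $\kappa_0>0$. Assume that for some $\tau,x>0$ $$|\mathbf m\cdot\mathbf J|\ \ge\ \frac{x|\mathbf J|}{|\mathbf m|^{\tau}}\qquad\text{for all } 0\neq\mathbf m\in\mathbb{Z}^q$$ (Euclidean norms), and let $p>q+\tau$ and $\epsilon=\frac{g}{|\mathbf J|}\bigl(1+\frac1x\bigr)$. **Theorem.** There are constants $c,C,\epsilon_0>0$ depending only on $\kappa_0,\gamma,q,p$ (in particular not on $\Lambda$) such that, if $\epsilon\le\epsilon_0$ and $\kappa=c\,\kappa_0|\log\epsilon|^{-1}$, there are a unitary $\hat Y$ and potentials $\hat D,\hat V$ with Hermitian terms such that $$\hat Y H\hat Y^\dagger=H^0+\hat D+\hat V$$ and the following hold. 1. $[N^{(\alpha)},\hat D]=0$ for $\alpha=1,\dots,q$. 2. $\|\hat D\|_\kappa\le Cg$ and $\|\hat V\|_\kappa\le g\exp\bigl(-c\,(1/\epsilon)^{1/p}\bigr)$. 3. $\hat Y$ is quasi-local and close to the identity: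 for every potential $G$, the operator $\hat YG\hat Y^\dagger-G$ is given by a potential of norm $\|\hat YG\hat Y^\dagger-G\|_\kappa\le C\epsilon\,\|G\|_{\kappa_0}$; and for every operator $O$ supported in a set $S$, $\|\hat YO\hat Y^\dagger-O\|\le C\epsilon\,|S|\,\|O\|$. 4. The dressed charges $\hat N^{(\alpha)}=\hat Y^\dagger N^{(\alpha)}\hat Y$ are quasi-conserved: $$\tfrac1{|\Lambda|}\bigl\|e^{itH}\hat N^{(\alpha)}e^{-itH}-\hat N^{(\alpha)}\bigr\|\le g\exp\bigl(-c(1/\epsilon)^{1/p}\bigr)\quad\text{for } |t|\le \exp\bigl(c(1/\epsilon)^{1/p}\bigr),$$ and the same quantity is at most $C\exp\bigl(-c(1/\epsilon)^{1/p}\bigr)$ for $|t|\le\frac cg\exp\bigl(c(1/\epsilon)^{1/p}\bigr)$. -/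

import Mathlib

open scoped Matrix.Norms.L2Operator

namespace SpinSystem

/-- Operators on the Hilbert space `(ℂ^d)^{⊗ Λ}`, written as matrices in the product basis, which is
indexed by the configurations `Λ → Fin d`. The norm is the operator norm of the Euclidean norm
(scope `Matrix.Norms.L2Operator`), and `star` is the conjugate transpose. -/
abbrev Op (Λ : Type*) (d : ℕ) : Type _ := Matrix (Λ → Fin d) (Λ → Fin d) ℂ

section

variable {Λ : Type*} [Fintype Λ] [DecidableEq Λ] {d q : ℕ}

/-- `O` has the form `A ⊗ 1`, with `A` acting on the sites in `S` and `1` on the other sites. -/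
def SupportedIn (S : Finset Λ) (O : Op Λ d) : Prop :=
  ∃ A : Matrix (S → Fin d) (S → Fin d) ℂ, ∀ σ σ' : Λ → Fin d,
    O σ σ' = if ∀ i, i ∉ S → σ i = σ' i then A (fun i => σ i) (fun i => σ' i) else 0

/-- Local terms `N α S` of `q` charges on the finite graph `𝒢`: Hermitian, supported in `S`, mutually
commuting, with integer spectrum, of range `R` and with local bound `γ`. -/
structure IsChargeFamily (𝒢 : SimpleGraph Λ) (R : ℕ) (γ : ℝ)
    (N : Fin q → Finset Λ → Op Λ d) : Prop where
  supported : ∀ α S, SupportedIn S (N α S)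
  selfAdjoint : ∀ α S, IsSelfAdjoint (N α S)
  commute : ∀ α β S T, Commute (N α S) (N β T)
  integer_spectrum : ∀ α S, ∀ z ∈ spectrum ℂ (N α S), ∃ k : ℤ, z = (k : ℂ)
  range : ∀ α S, N α S ≠ 0 → ∀ i ∈ S, ∀ j ∈ S, 𝒢.edist i j ≤ (R : ℕ∞)
  local_bound : ∀ α i, ∑ S : Finset Λ with i ∈ S, ‖N α S‖ ≤ γ

/-- `O` is supported in `S` and commutes with every local charge whose set is not inside `S`. -/
def StronglySupportedIn (N : Fin q → Finset Λ → Op Λ d) (S : Finset Λ) (O : Op Λ d) : Prop :=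
  SupportedIn S O ∧ ∀ α S', ¬ S' ⊆ S → Commute O (N α S')

/-- `S` is a (nonempty) connected set of sites. -/
def IsConnectedSet (𝒢 : SimpleGraph Λ) (S : Finset Λ) : Prop :=
  (𝒢.induce (S : Set Λ)).Connected

/-- A potential: a family of operators `G S`, one for each connected `S`, with `G S` strongly supported
in `S`. The family is extended by zero to the sets that are not connected. -/
structure IsPotential (𝒢 : SimpleGraph Λ) (N : Fin q → Finset Λ → Op Λ d)
    (G : Finset Λ → Op Λ d) : Prop where
  stronglySupported : ∀ S, IsConnectedSet 𝒢 S → StronglySupportedIn N S (G S)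
  eq_zero : ∀ S, ¬ IsConnectedSet 𝒢 S → G S = 0

/-- The operator `∑_S G S` defined by a family of local terms. -/
def total (G : Finset Λ → Op Λ d) : Op Λ d := ∑ S, G S

open Classical in
/-- The local norm `max_i ∑_{S ∋ i connected} e^{κ|S|} ‖G S‖`. -/
noncomputable def localNorm (𝒢 : SimpleGraph Λ) (κ : ℝ) (G : Finset Λ → Op Λ d) : ℝ :=
  ⨆ i : Λ, ∑ S : Finset Λ with IsConnectedSet 𝒢 S ∧ i ∈ S,
    Real.exp (κ * (S.card : ℝ)) * ‖G S‖

/-- `H⁰ = ∑_α J_α N^{(α)}`. -/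
noncomputable def freeHamiltonian (J : EuclideanSpace ℝ (Fin q))
    (N : Fin q → Finset Λ → Op Λ d) : Op Λ d :=
  ∑ α, (J α : ℂ) • total (N α)

/-- Heisenberg evolution `e^{itH} O e^{-itH}`. -/
noncomputable def heisenberg (H : Op Λ d) (t : ℝ) (O : Op Λ d) : Op Λ d :=
  NormedSpace.exp ((Complex.I * (t : ℂ)) • H) * O * NormedSpace.exp (-((Complex.I * (t : ℂ)) • H))

end

/-- The Diophantine condition `|m · J| ≥ x |J| / |m|^τ` for nonzero integer vectors `m`, with
Euclidean norms. -/
def Diophantine {q : ℕ} (J : EuclideanSpace ℝ (Fin q)) (x τ : ℝ) : Prop :=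
  ∀ m : Fin q → ℤ, m ≠ 0 →
    x * ‖J‖ / ‖WithLp.toLp 2 (fun α => (m α : ℝ))‖ ^ τ ≤ |∑ α, (m α : ℝ) * J α|

/-- The small parameter `ε = (g / |J|) (1 + 1/x)`. -/
noncomputable def smallParameter {q : ℕ} (g : ℝ) (J : EuclideanSpace ℝ (Fin q)) (x : ℝ) : ℝ :=
  g / ‖J‖ * (1 + 1 / x)

/-- The decay rate `κ = c κ₀ / |log ε|`. -/
noncomputable def decayRate (c κ₀ ε : ℝ) : ℝ := c * κ₀ * |Real.log ε|⁻¹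

end SpinSystem

/-! The proof is a KAM-type normal form. Each step conjugates by `exp A`, where `A` is a
skew-adjoint potential solving a homological equation: the commutator of `A` with `H⁰` is `X - V`,
and `X` is the part of the remainder `V` that commutes with all charges. The conjugation removes `V`
to first order and leaves `X`, which joins `D`. The new remainder consists of commutators with `A`.

Strong support makes the equation local. A term on `S` sees only the charges inside `S`, whose joint
eigenvalues are integer vectors of size `O(|S|)`. In a joint eigenbasis the solution divides matrix
entries by `m · J`, with `m` the difference of two such vectors (`exists_homological_solution`). Its
norm is at most a sum of `1/|m · J|` over a box. Differences of box vectors are again integer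
vectors, so the Diophantine condition also separates the values `m · J`. The sum is therefore a
logarithm divided by the smallest divisor, and hence `O(|S|^(p-1))` (`exists_divisor_bound`).

This polynomial factor costs `δ^(-(p-1))` when the decay rate drops by `δ`, and conjugation costs a
further `1/δ` (`LocBound.weight`, `LocBound.adPot_iterate`). One step thus multiplies the remainder
by about `δ^(-p) ε` (`IsFrame.step`). A first step with fixed `δ` makes the remainder `O(ε g)`, so
that all rotations together stay `O(ε)` from the identity. Then `n` steps with `δ` of order `1/n`
halve the remainder each time, which is possible as long as `n^p ε` is small. Taking `n` of order
`ε^(-1/p)` gives the exponential bound.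

The free part and `D` commute with the charges, so only `V` moves the dressed charges. Their drift
is at most `|t|` times an extensive commutator of size `|Λ| ‖V‖` (`IsFrame.heisenberg_sub_le`). -/

namespace SpinSystem

set_option linter.unusedSectionVars false

/-! ### Supports as commutants, and the algebra of strongly supported operators -/

section Support

variable {Λ : Type*} [Fintype Λ] [DecidableEq Λ] {d q : ℕ}

/-- Operators supported in disjoint sets commute. -/
theorem SupportedIn.commute_of_disjoint {S T : Finset Λ} {A B : Op Λ d}
    (hA : SupportedIn S A) (hB : SupportedIn T B) (hST : Disjoint S T) : Commute A B := by
  obtain ⟨a, ha⟩ := hA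
  obtain ⟨b, hb⟩ := hB
  have hnot : ∀ i ∈ S, i ∉ T := fun i hi hi' => Finset.disjoint_left.mp hST hi hi'
  have hnot' : ∀ i ∈ T, i ∉ S := fun i hi hi' => Finset.disjoint_left.mp hST hi' hi
  ext σ σ'
  rw [Matrix.mul_apply, Matrix.mul_apply]
  -- Only one intermediate configuration contributes to each product: `A * B` changes the sites of
  -- `S` first, `B * A` those of `T`.
  set ρ₁ : Λ → Fin d := fun i => if i ∈ S then σ' i else σ i with hρ₁
  set ρ₂ : Λ → Fin d := fun i => if i ∈ T then σ' i else σ i with hρ₂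
  rw [Finset.sum_eq_single ρ₁, Finset.sum_eq_single ρ₂]
  · have e1 : A σ ρ₁ = a (fun i => σ i) (fun i => σ' i) := by
      rw [ha, if_pos (by intro i hi; simp [hρ₁, hi])]
      congr 1; ext i; simp [hρ₁]
    have e2 : B σ ρ₂ = b (fun i => σ i) (fun i => σ' i) := by
      rw [hb, if_pos (by intro i hi; simp [hρ₂, hi])]
      congr 1; ext i; simp [hρ₂]
    have e3 : B ρ₁ σ' = if ∀ i, i ∉ S → i ∉ T → σ i = σ' i then
        b (fun i => σ i) (fun i => σ' i) else 0 := by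
      rw [hb]
      have h1 : (∀ i, i ∉ T → ρ₁ i = σ' i) ↔ ∀ i, i ∉ S → i ∉ T → σ i = σ' i := by
        constructor
        · intro h i hi hi'
          simpa [hρ₁, hi] using h i hi'
        · intro h i hi
          by_cases hS : i ∈ S
          · simp [hρ₁, hS]
          · simpa [hρ₁, hS] using h i hS hi
      have h2 : (fun i : T => ρ₁ i) = fun i : T => σ i := by
        ext i; simp [hρ₁, hnot' i i.2]
      simp only [h1, h2]
    have e4 : A ρ₂ σ' = if ∀ i, i ∉ S → i ∉ T → σ i = σ' i then
        a (fun i => σ i) (fun i => σ' i) else 0 := by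
      rw [ha]
      have h1 : (∀ i, i ∉ S → ρ₂ i = σ' i) ↔ ∀ i, i ∉ S → i ∉ T → σ i = σ' i := by
        constructor
        · intro h i hi hi'
          simpa [hρ₂, hi'] using h i hi
        · intro h i hi
          by_cases hT : i ∈ T
          · simp [hρ₂, hT]
          · simpa [hρ₂, hT] using h i hi hT
      have h2 : (fun i : S => ρ₂ i) = fun i : S => σ i := by
        ext i; simp [hρ₂, hnot i i.2]
      simp only [h1, h2]
    rw [e1, e2, e3, e4]
    split_ifs
    · ring
    · ring
  · intro ρ _ hρ
    by_contra hne
    apply hρ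
    have h1 : ∀ i, i ∉ T → σ i = ρ i := by
      by_contra h; exact hne (by rw [hb σ ρ, if_neg h, zero_mul])
    have h2 : ∀ i, i ∉ S → ρ i = σ' i := by
      by_contra h; exact hne (by rw [ha ρ σ', if_neg h, mul_zero])
    ext i
    by_cases hT : i ∈ T
    · simp [hρ₂, hT, h2 i (hnot' i hT)]
    · simp [hρ₂, hT, h1 i hT]
  · simp
  · intro ρ _ hρ
    by_contra hne
    apply hρ
    have h1 : ∀ i, i ∉ S → σ i = ρ i := by
      by_contra h; exact hne (by rw [ha σ ρ, if_neg h, zero_mul])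
    have h2 : ∀ i, i ∉ T → ρ i = σ' i := by
      by_contra h; exact hne (by rw [hb ρ σ', if_neg h, mul_zero])
    ext i
    by_cases hS : i ∈ S
    · simp [hρ₁, hS, h2 i (hnot i hS)]
    · simp [hρ₁, hS, h1 i hS]
  · simp

/-- The configuration equal to `σ` on `S` and to `τ` elsewhere. -/
def glue (S : Finset Λ) (σ τ : Λ → Fin d) : Λ → Fin d := fun i => if i ∈ S then σ i else τ i

/-- The matrix unit `1_S ⊗ |τ⟩⟨τ'|` of the complement of `S`. -/
def complUnit (S : Finset Λ) (τ τ' : Λ → Fin d) : Op Λ d := fun σ σ' =>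
  if σ = glue S σ' τ ∧ σ' = glue S σ τ' then 1 else 0

theorem supportedIn_complUnit (S : Finset Λ) (τ τ' : Λ → Fin d) :
    SupportedIn Sᶜ (complUnit S τ τ') := by
  refine ⟨fun s s' => if (∀ i : (Sᶜ : Finset Λ), s i = τ i) ∧
    (∀ i : (Sᶜ : Finset Λ), s' i = τ' i) then 1 else 0, fun σ σ' => ?_⟩
  unfold complUnit
  rw [← ite_and]
  congr 1
  simp only [eq_iff_iff, funext_iff, glue, Finset.mem_compl, not_not, Subtype.forall]
  constructor
  · rintro ⟨h, h'⟩
    refine ⟨fun i hi => by simpa [hi] using h i, fun i hi => ?_, fun i hi => ?_⟩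
    · simpa [hi] using h i
    · simpa [hi] using h' i
  · rintro ⟨h, h', h''⟩
    refine ⟨fun i => ?_, fun i => ?_⟩
    · by_cases hi : i ∈ S
      · simpa [hi] using h i hi
      · simpa [hi] using h' i hi
    · by_cases hi : i ∈ S
      · simpa [hi] using (h i hi).symm
      · simpa [hi] using h'' i hi

theorem mul_complUnit_apply (S : Finset Λ) (τ τ' σ σ' : Λ → Fin d) (O : Op Λ d) :
    (O * complUnit S τ τ') σ σ' =
      if σ' = glue S σ' τ' then O σ (glue S σ' τ) else 0 := by
  rw [Matrix.mul_apply, Finset.sum_eq_single (glue S σ' τ)]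
  · have : glue S (glue S σ' τ) τ' = glue S σ' τ' := by
      ext i; by_cases hi : i ∈ S <;> simp [glue, hi]
    simp [complUnit, this]
  · intro ρ _ hρ
    simp [complUnit, hρ]
  · simp

theorem complUnit_mul_apply (S : Finset Λ) (τ τ' σ σ' : Λ → Fin d) (O : Op Λ d) :
    (complUnit S τ τ' * O) σ σ' =
      if σ = glue S σ τ then O (glue S σ τ') σ' else 0 := by
  rw [Matrix.mul_apply, Finset.sum_eq_single (glue S σ τ')]
  · have : glue S (glue S σ τ') τ = glue S σ τ := by
      ext i; by_cases hi : i ∈ S <;> simp [glue, hi]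
    simp [complUnit, this]
  · intro ρ _ hρ
    simp [complUnit, hρ]
  · simp

/-- The operators supported in `S` are the commutant of those supported in the complement. -/
theorem supportedIn_iff_commute {S : Finset Λ} {O : Op Λ d} :
    SupportedIn S O ↔ ∀ B, SupportedIn Sᶜ B → Commute B O := by
  refine ⟨fun h B hB => hB.commute_of_disjoint h disjoint_compl_left, fun h => ?_⟩
  rcases isEmpty_or_nonempty (Λ → Fin d) with he | ⟨⟨ρ⟩⟩
  · exact ⟨0, fun σ => he.elim σ⟩
  have key : ∀ τ τ' σ σ' : Λ → Fin d, (complUnit S τ τ' * O) σ σ' = (O * complUnit S τ τ') σ σ' :=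
    fun τ τ' σ σ' => by rw [(h _ (supportedIn_complUnit S τ τ')).eq]
  refine ⟨fun s s' => O (fun i => if hi : i ∈ S then s ⟨i, hi⟩ else ρ i)
    (fun i => if hi : i ∈ S then s' ⟨i, hi⟩ else ρ i), fun σ σ' => ?_⟩
  have hg : ∀ σ τ : Λ → Fin d, σ = glue S σ τ ↔ ∀ i, i ∉ S → σ i = τ i := by
    intro σ τ
    rw [funext_iff]
    refine forall_congr' fun i => ?_
    by_cases hi : i ∈ S <;> simp [glue, hi]
  split_ifs with hσ
  -- When `σ` and `σ'` agree off `S`, a matrix unit replaces their common outer part by the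
  -- reference `ρ`, so the entry depends only on the values in `S`.
  · have h1 := key σ ρ σ (glue S σ' ρ)
    rw [complUnit_mul_apply, mul_complUnit_apply, if_pos ((hg _ _).2 fun _ _ => rfl),
      if_pos (by ext i; by_cases hi : i ∈ S <;> simp [glue, hi])] at h1
    have h2 : glue S (glue S σ' ρ) σ = σ' := by
      ext i; by_cases hi : i ∈ S <;> simp [glue, hi]
      rw [hσ i hi]
    rw [h2] at h1
    rw [← h1]
    rfl
  -- Here the unit is the projection onto the outer part of `σ'`: it kills row `σ` and fixes column
  -- `σ'`, so the entry vanishes.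
  · have h1 := key σ' σ' σ σ'
    rw [complUnit_mul_apply, mul_complUnit_apply, if_neg (by rwa [hg]),
      if_pos ((hg _ _).2 fun _ _ => rfl)] at h1
    rw [← (hg σ' σ').2 fun _ _ => rfl] at h1
    exact h1.symm

theorem SupportedIn.mono {S T : Finset Λ} {O : Op Λ d} (h : SupportedIn S O) (hST : S ⊆ T) :
    SupportedIn T O := by
  rw [supportedIn_iff_commute]
  intro B hB
  exact hB.commute_of_disjoint h
    (Finset.disjoint_left.mpr fun i hi hi' => (Finset.mem_compl.mp hi) (hST hi'))

/-- The operators whose commutant consists of the operators strongly supported in `S`. -/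
def strongSet (N : Fin q → Finset Λ → Op Λ d) (S : Finset Λ) : Set (Op Λ d) :=
  {B | SupportedIn Sᶜ B} ∪ {B | ∃ α S', ¬ S' ⊆ S ∧ B = N α S'}

/-- The algebra of operators strongly supported in `S`. -/
def strongAlgebra (N : Fin q → Finset Λ → Op Λ d) (S : Finset Λ) : Subalgebra ℂ (Op Λ d) :=
  Subalgebra.centralizer ℂ (strongSet N S)

/-- Both conditions of strong support are commutation conditions. Products, commutators and, in
finite dimension, limits therefore stay strongly supported, which is what the commutator series
need. -/
theorem mem_strongAlgebra {N : Fin q → Finset Λ → Op Λ d} {S : Finset Λ} {O : Op Λ d} :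
    O ∈ strongAlgebra N S ↔ StronglySupportedIn N S O := by
  rw [strongAlgebra, Subalgebra.mem_centralizer_iff, StronglySupportedIn, supportedIn_iff_commute]
  constructor
  · intro h
    exact ⟨fun B hB => h B (Or.inl hB), fun α S' hS' => (h _ (Or.inr ⟨α, S', hS', rfl⟩)).symm⟩
  · rintro ⟨h, h'⟩ B (hB | ⟨α, S', hS', rfl⟩)
    · exact h B hB
    · exact (h' α S' hS').symm

theorem strongAlgebra_mono (N : Fin q → Finset Λ → Op Λ d) {S T : Finset Λ} (hST : S ⊆ T) :
    strongAlgebra N S ≤ strongAlgebra N T := by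
  intro O hO
  rw [mem_strongAlgebra] at hO ⊢
  exact ⟨hO.1.mono hST, fun α S' hS' => hO.2 α S' fun h => hS' (h.trans hST)⟩

theorem isClosed_strongAlgebra (N : Fin q → Finset Λ → Op Λ d) (S : Finset Λ) :
    IsClosed (strongAlgebra N S : Set (Op Λ d)) :=
  (Subalgebra.toSubmodule (strongAlgebra N S)).closed_of_finiteDimensional

theorem IsPotential.mem {𝒢 : SimpleGraph Λ} {N : Fin q → Finset Λ → Op Λ d}
    {G : Finset Λ → Op Λ d} (h : IsPotential 𝒢 N G) (S : Finset Λ) : G S ∈ strongAlgebra N S := by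
  by_cases hS : IsConnectedSet 𝒢 S
  · exact mem_strongAlgebra.2 (h.stronglySupported S hS)
  · rw [h.eq_zero S hS]; exact zero_mem _

theorem isPotential_of_mem {𝒢 : SimpleGraph Λ} {N : Fin q → Finset Λ → Op Λ d}
    {G : Finset Λ → Op Λ d} (h : ∀ S, G S ∈ strongAlgebra N S)
    (h' : ∀ S, ¬ IsConnectedSet 𝒢 S → G S = 0) : IsPotential 𝒢 N G :=
  ⟨fun S _ => mem_strongAlgebra.1 (h S), h'⟩

theorem IsPotential.add {𝒢 : SimpleGraph Λ} {N : Fin q → Finset Λ → Op Λ d}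
    {G K : Finset Λ → Op Λ d} (hG : IsPotential 𝒢 N G) (hK : IsPotential 𝒢 N K) :
    IsPotential 𝒢 N (G + K) :=
  isPotential_of_mem (fun S => add_mem (hG.mem S) (hK.mem S)) fun S hS => by
    simp [hG.eq_zero S hS, hK.eq_zero S hS]

theorem IsPotential.smul {𝒢 : SimpleGraph Λ} {N : Fin q → Finset Λ → Op Λ d}
    {G : Finset Λ → Op Λ d} (hG : IsPotential 𝒢 N G) (z : ℂ) : IsPotential 𝒢 N (z • G) :=
  isPotential_of_mem (fun S => Subalgebra.smul_mem _ (hG.mem S) z) fun S hS => by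
    simp [hG.eq_zero S hS]

theorem IsPotential.sub {𝒢 : SimpleGraph Λ} {N : Fin q → Finset Λ → Op Λ d}
    {G K : Finset Λ → Op Λ d} (hG : IsPotential 𝒢 N G) (hK : IsPotential 𝒢 N K) :
    IsPotential 𝒢 N (G - K) :=
  isPotential_of_mem (fun S => sub_mem (hG.mem S) (hK.mem S)) fun S hS => by
    simp [hG.eq_zero S hS, hK.eq_zero S hS]

theorem isPotential_zero {𝒢 : SimpleGraph Λ} {N : Fin q → Finset Λ → Op Λ d} :
    IsPotential 𝒢 N (0 : Finset Λ → Op Λ d) :=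
  isPotential_of_mem (fun _ => zero_mem _) fun _ _ => rfl

theorem not_isConnectedSet_empty {𝒢 : SimpleGraph Λ} : ¬ IsConnectedSet 𝒢 (∅ : Finset Λ) := by
  intro h
  obtain ⟨⟨i, hi⟩⟩ := h.nonempty
  simp at hi

theorem IsConnectedSet.union {𝒢 : SimpleGraph Λ} {S T : Finset Λ} (hS : IsConnectedSet 𝒢 S)
    (hT : IsConnectedSet 𝒢 T) (h : (S ∩ T).Nonempty) : IsConnectedSet 𝒢 (S ∪ T) := by
  rw [IsConnectedSet, Finset.coe_union]
  exact SimpleGraph.induce_union_connected hS.preconnected hT.preconnected (by exact_mod_cast h)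

@[simp] theorem total_add (G K : Finset Λ → Op Λ d) : total (G + K) = total G + total K := by
  simp [total, Finset.sum_add_distrib]

@[simp] theorem total_sub (G K : Finset Λ → Op Λ d) : total (G - K) = total G - total K := by
  simp [total, Finset.sum_sub_distrib]

@[simp] theorem total_zero : total (0 : Finset Λ → Op Λ d) = 0 := by
  simp [total]

theorem isSelfAdjoint_total {G : Finset Λ → Op Λ d} (h : ∀ S, IsSelfAdjoint (G S)) :
    IsSelfAdjoint (total G) := by
  rw [total, isSelfAdjoint_iff, star_sum]
  exact Finset.sum_congr rfl fun S _ => (h S).star_eq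

end Support

/-! ### Conjugation by exponentials -/

section Exponential

open NormedSpace

variable {𝔸 : Type*} [CStarAlgebra 𝔸]

/-- The commutator `[a, x]` as a function of `x`. -/
def comm (a x : 𝔸) : 𝔸 := a * x - x * a

/-- The commutator map is left multiplication by `a` plus right multiplication by `-a`. These
commute, so the binomial theorem applies. -/
theorem comm_iterate_eq_sum (a x : 𝔸) (n : ℕ) :
    ((n.factorial : ℂ)⁻¹) • (comm a)^[n] x = ∑ ij ∈ Finset.HasAntidiagonal.antidiagonal n,
      (((ij.1.factorial : ℂ)⁻¹ • a ^ ij.1) * x) * ((ij.2.factorial : ℂ)⁻¹ • (-a) ^ ij.2) := by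
  have h1 : (comm a)^[n] x = ((LinearMap.mulLeft ℂ a + LinearMap.mulRight ℂ (-a)) ^ n) x := by
    rw [Module.End.pow_apply]
    congr 2
    ext y; simp [comm, sub_eq_add_neg]
  have hc : Commute (LinearMap.mulLeft ℂ a) (LinearMap.mulRight ℂ (-a)) :=
    LinearMap.commute_mulLeft_right ..
  rw [h1, hc.add_pow', LinearMap.sum_apply, Finset.smul_sum]
  refine Finset.sum_congr rfl fun ij hij => ?_
  rw [Finset.HasAntidiagonal.mem_antidiagonal] at hij
  rw [LinearMap.pow_mulLeft, LinearMap.pow_mulRight, LinearMap.smul_apply, Module.End.mul_apply,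
    LinearMap.mulRight_apply, LinearMap.mulLeft_apply, smul_mul_assoc, smul_mul_assoc,
    mul_smul_comm, smul_smul, ← Nat.cast_smul_eq_nsmul ℂ, smul_smul, mul_assoc]
  congr 1
  subst hij
  rw [Nat.choose_symm_add, Nat.add_choose]
  have := Nat.factorial_mul_factorial_dvd_factorial_add ij.1 ij.2
  rw [Nat.cast_div this (by
    exact_mod_cast Nat.mul_ne_zero (Nat.factorial_ne_zero _) (Nat.factorial_ne_zero _))]
  have h1 : ((ij.1 + ij.2).factorial : ℂ) ≠ 0 := by exact_mod_cast Nat.factorial_ne_zero _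
  push_cast
  field_simp

/-- The Cauchy product of the series of `exp a * x` and `exp (-a)`. -/
theorem hasSum_comm_iterate (a x : 𝔸) :
    HasSum (fun n : ℕ => ((n.factorial : ℂ)⁻¹) • (comm a)^[n] x) (exp a * x * exp (-a)) := by
  have hs : ∀ b : 𝔸, Summable fun n : ℕ => ‖((n.factorial : ℂ)⁻¹) • b ^ n‖ := fun b =>
    norm_expSeries_summable' b
  have hs' : Summable fun n : ℕ => ‖(((n.factorial : ℂ)⁻¹) • a ^ n) * x‖ :=
    ((hs a).mul_right ‖x‖).of_nonneg_of_le (fun _ => norm_nonneg _) fun _ => norm_mul_le _ _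
  have h := tsum_mul_tsum_eq_tsum_sum_antidiagonal_of_summable_norm hs' (hs (-a))
  have hsum := (summable_norm_sum_mul_antidiagonal_of_summable_norm hs' (hs (-a))).of_norm
  simp_rw [comm_iterate_eq_sum]
  have he : exp a * x * exp (-a) = ∑' n : ℕ, ∑ ij ∈ Finset.HasAntidiagonal.antidiagonal n,
      (((ij.1.factorial : ℂ)⁻¹ • a ^ ij.1) * x) * ((ij.2.factorial : ℂ)⁻¹ • (-a) ^ ij.2) := by
    rw [← h, (hs a).of_norm.tsum_mul_right, exp_eq_tsum ℂ]
  rw [he]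
  exact hsum.hasSum

/-- Conjugation by the exponential of a skew-adjoint element moves `x` by at most the norm of the
commutator. -/
theorem norm_exp_conj_sub_le {a : 𝔸} (ha : star a = -a) (x : 𝔸) :
    ‖exp a * x * exp (-a) - x‖ ≤ ‖comm a x‖ := by
  let +nondep : NormedAlgebra ℚ 𝔸 := .restrictScalars ℚ ℂ 𝔸
  have hu : ∀ s : ℝ, exp (s • a) ∈ unitary 𝔸 := fun s =>
    exp_mem_unitary_of_mem_skewAdjoint (by
      rw [skewAdjoint.mem_iff, star_smul, ha]; simp)
  -- The derivative along the path is a unitary conjugate of `comm a x`, so its norm is constant and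
  -- the mean value inequality applies.
  have hd : ∀ s : ℝ, HasDerivAt (fun s : ℝ => exp (s • a) * x * exp (s • (-a)))
      (exp (s • a) * comm a x * exp (s • (-a))) s := by
    intro s
    have h1 := hasDerivAt_exp_smul_const (𝕂 := ℝ) a s
    have h2 := hasDerivAt_exp_smul_const' (𝕂 := ℝ) (-a) s
    refine ((h1.mul_const x).mul h2).congr_deriv ?_
    simp only [comm]
    noncomm_ring
  have hinv : ∀ s : ℝ, exp (s • (-a)) = star (exp (s • a)) := by
    intro s
    rw [star_exp, star_smul, ha]; simp
  have key := norm_image_sub_le_of_norm_deriv_le_segment_01'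
    (f := fun s : ℝ => exp (s • a) * x * exp (s • (-a))) (C := ‖comm a x‖)
    (fun s _ => (hd s).hasDerivWithinAt) (fun s _ => by
      rw [hinv, mul_assoc, CStarRing.norm_mem_unitary_mul _ (hu s),
        CStarRing.norm_mul_mem_unitary _ (Unitary.star_mem (hu s))])
  simpa using key

theorem norm_unitary_conj {u : 𝔸} (hu : u ∈ unitary 𝔸) (x : 𝔸) : ‖u * x * star u‖ = ‖x‖ := by
  rw [CStarRing.norm_mul_mem_unitary _ (Unitary.star_mem hu), CStarRing.norm_mem_unitary_mul _ hu]

theorem norm_comm_le (a x : 𝔸) : ‖comm a x‖ ≤ 2 * ‖a‖ * ‖x‖ := by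
  calc ‖comm a x‖ ≤ ‖a * x‖ + ‖x * a‖ := norm_sub_le _ _
    _ ≤ ‖a‖ * ‖x‖ + ‖x‖ * ‖a‖ := add_le_add (norm_mul_le _ _) (norm_mul_le _ _)
    _ = _ := by ring

theorem exp_mem_unitary_of_star_eq_neg {a : 𝔸} (ha : star a = -a) : exp a ∈ unitary 𝔸 :=
  let +nondep : NormedAlgebra ℚ 𝔸 := .restrictScalars ℚ ℂ 𝔸
  exp_mem_unitary_of_mem_skewAdjoint (skewAdjoint.mem_iff.2 ha)

theorem star_exp_of_star_eq_neg {a : 𝔸} (ha : star a = -a) : star (exp a) = exp (-a) := by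
  rw [star_exp, ha]

end Exponential

/-! ### Local norms and commutators of potentials -/

section LocalBounds

variable {Λ : Type*} [Fintype Λ] [DecidableEq Λ] {d q : ℕ}

/-- `b` bounds the sums `∑_{S ∋ i} e^{κ|S|} ‖G S‖` for all sites `i`. -/
def LocBound (κ : ℝ) (G : Finset Λ → Op Λ d) (b : ℝ) : Prop :=
  ∀ i, ∑ S : Finset Λ with i ∈ S, Real.exp (κ * (S.card : ℝ)) * ‖G S‖ ≤ b

theorem locBound_localNorm {𝒢 : SimpleGraph Λ} {N : Fin q → Finset Λ → Op Λ d}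
    {G : Finset Λ → Op Λ d} (hG : IsPotential 𝒢 N G) (κ : ℝ) :
    LocBound κ G (localNorm 𝒢 κ G) := by
  classical
  intro i
  have h := le_ciSup (f := fun i : Λ => ∑ S : Finset Λ with IsConnectedSet 𝒢 S ∧ i ∈ S,
    Real.exp (κ * (S.card : ℝ)) * ‖G S‖) (Set.finite_range _).bddAbove i
  refine le_trans (le_of_eq ?_) (h.trans (le_of_eq ?_))
  · simp only [Finset.sum_filter]
    refine Finset.sum_congr rfl fun S _ => ?_
    by_cases hS : IsConnectedSet 𝒢 S
    · simp [hS]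
    · simp [hG.eq_zero S hS]
  · unfold localNorm
    congr!

/-- The sign of `b` matters only for empty `Λ`, where the supremum is `0`. -/
theorem LocBound.localNorm_le {𝒢 : SimpleGraph Λ} {κ b : ℝ} {G : Finset Λ → Op Λ d}
    (h : LocBound κ G b) (hb : 0 ≤ b) : localNorm 𝒢 κ G ≤ b := by
  classical
  refine Real.iSup_le (fun i => le_trans ?_ (h i)) hb
  refine Finset.sum_le_sum_of_subset_of_nonneg (fun S hS => ?_) fun _ _ _ => by positivity
  simp only [Finset.mem_filter, Finset.mem_univ, true_and] at hS ⊢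
  exact hS.2

theorem LocBound.mono {κ κ' b b' : ℝ} {G : Finset Λ → Op Λ d} (h : LocBound κ G b) (hκ : κ' ≤ κ)
    (hb : b ≤ b') : LocBound κ' G b' := fun i =>
  (Finset.sum_le_sum fun S _ => by gcongr).trans ((h i).trans hb)

theorem LocBound.add {κ b b' : ℝ} {G G' : Finset Λ → Op Λ d} (h : LocBound κ G b)
    (h' : LocBound κ G' b') : LocBound κ (G + G') (b + b') := fun i => by
  refine le_trans ?_ (add_le_add (h i) (h' i))
  rw [← Finset.sum_add_distrib]
  refine Finset.sum_le_sum fun S _ => ?_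
  rw [← mul_add]
  gcongr
  exact norm_add_le _ _

theorem LocBound.sub {κ b b' : ℝ} {G G' : Finset Λ → Op Λ d} (h : LocBound κ G b)
    (h' : LocBound κ G' b') : LocBound κ (G - G') (b + b') := fun i => by
  refine le_trans ?_ (add_le_add (h i) (h' i))
  rw [← Finset.sum_add_distrib]
  refine Finset.sum_le_sum fun S _ => ?_
  rw [← mul_add]
  gcongr
  exact norm_sub_le _ _

theorem locBound_zero (κ : ℝ) : LocBound κ (0 : Finset Λ → Op Λ d) 0 := fun i => by simp

theorem LocBound.of_norm_le {κ b : ℝ} {G G' : Finset Λ → Op Λ d} (h : LocBound κ G b)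
    (h' : ∀ S, ‖G' S‖ ≤ ‖G S‖) : LocBound κ G' b := fun i =>
  (Finset.sum_le_sum fun S _ => by gcongr; exact h' S).trans (h i)

theorem LocBound.norm_le {κ b : ℝ} {G : Finset Λ → Op Λ d} (h : LocBound κ G b) (hκ : 0 ≤ κ)
    {S : Finset Λ} (hS : S.Nonempty) : ‖G S‖ ≤ b := by
  obtain ⟨i, hi⟩ := hS
  refine le_trans ?_ (h i)
  refine le_trans ?_ (Finset.single_le_sum
    (f := fun S : Finset Λ => Real.exp (κ * (S.card : ℝ)) * ‖G S‖)
    (fun _ _ => by positivity) (Finset.mem_filter.2 ⟨Finset.mem_univ S, hi⟩))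
  have : 1 ≤ Real.exp (κ * (S.card : ℝ)) := Real.one_le_exp (by positivity)
  nlinarith [norm_nonneg (G S)]

/-- A family of terms for the commutator of two families of local terms. -/
noncomputable def adPot (A G : Finset Λ → Op Λ d) : Finset Λ → Op Λ d := fun S =>
  ∑ p : Finset Λ × Finset Λ with p.1 ∪ p.2 = S ∧ (p.1 ∩ p.2).Nonempty, comm (A p.1) (G p.2)

/-- `LocBound` says nothing about the term at `∅`; this vanishing makes the commutator series
summable there. -/
theorem adPot_empty (A G : Finset Λ → Op Λ d) : adPot A G ∅ = 0 := by
  rw [adPot, Finset.sum_eq_zero]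
  rintro ⟨S, T⟩ h
  simp only [Finset.mem_filter, Finset.mem_univ, true_and] at h
  obtain ⟨h, i, hi⟩ := h
  have : i ∈ S ∪ T := Finset.mem_union_left _ (Finset.mem_inter.1 hi).1
  simp [h] at this

theorem comm_mem {B : Subalgebra ℂ (Op Λ d)} {x y : Op Λ d} (hx : x ∈ B) (hy : y ∈ B) :
    comm x y ∈ B :=
  sub_mem (mul_mem hx hy) (mul_mem hy hx)

theorem IsPotential.adPot {𝒢 : SimpleGraph Λ} {N : Fin q → Finset Λ → Op Λ d}
    {A G : Finset Λ → Op Λ d} (hA : IsPotential 𝒢 N A) (hG : IsPotential 𝒢 N G) :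
    IsPotential 𝒢 N (adPot A G) := by
  refine isPotential_of_mem (fun S => sum_mem fun p hp => ?_) fun S hS =>
    Finset.sum_eq_zero fun p hp => ?_
  · simp only [Finset.mem_filter, Finset.mem_univ, true_and] at hp
    rw [← hp.1]
    exact comm_mem (strongAlgebra_mono N Finset.subset_union_left (hA.mem _))
      (strongAlgebra_mono N Finset.subset_union_right (hG.mem _))
  · simp only [Finset.mem_filter, Finset.mem_univ, true_and] at hp
    by_cases h1 : IsConnectedSet 𝒢 p.1
    · by_cases h2 : IsConnectedSet 𝒢 p.2
      · exact absurd (hp.1 ▸ h1.union h2 hp.2) hS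
      · simp [comm, hG.eq_zero _ h2]
    · simp [comm, hA.eq_zero _ h1]

theorem IsPotential.supportedIn {𝒢 : SimpleGraph Λ} {N : Fin q → Finset Λ → Op Λ d}
    {G : Finset Λ → Op Λ d} (hG : IsPotential 𝒢 N G) (S : Finset Λ) : SupportedIn S (G S) :=
  (mem_strongAlgebra.1 (hG.mem S)).1

theorem comm_sum_left {ι : Type*} (s : Finset ι) (f : ι → Op Λ d) (x : Op Λ d) :
    comm (∑ i ∈ s, f i) x = ∑ i ∈ s, comm (f i) x := by
  simp [comm, Finset.sum_mul, Finset.mul_sum]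

theorem comm_sum_right {ι : Type*} (s : Finset ι) (f : ι → Op Λ d) (x : Op Λ d) :
    comm x (∑ i ∈ s, f i) = ∑ i ∈ s, comm x (f i) := by
  simp [comm, Finset.sum_mul, Finset.mul_sum]

/-- Terms with disjoint supports commute; the remaining pairs are grouped by their union. -/
theorem total_adPot {𝒢 : SimpleGraph Λ} {N : Fin q → Finset Λ → Op Λ d}
    {A G : Finset Λ → Op Λ d} (hA : IsPotential 𝒢 N A) (hG : IsPotential 𝒢 N G) :
    total (adPot A G) = comm (total A) (total G) := by
  have h1 : comm (total A) (total G) = ∑ p : Finset Λ × Finset Λ, comm (A p.1) (G p.2) := by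
    rw [total, total, comm_sum_left, Fintype.sum_prod_type]
    exact Finset.sum_congr rfl fun S _ => comm_sum_right _ _ _
  have h2 : ∑ p : Finset Λ × Finset Λ, comm (A p.1) (G p.2) =
      ∑ p : Finset Λ × Finset Λ with (p.1 ∩ p.2).Nonempty, comm (A p.1) (G p.2) := by
    rw [Finset.sum_filter]
    refine Finset.sum_congr rfl fun p _ => ?_
    split_ifs with h
    · rfl
    · have := (hA.supportedIn p.1).commute_of_disjoint (hG.supportedIn p.2)
        (Finset.disjoint_iff_inter_eq_empty.2 (Finset.not_nonempty_iff_eq_empty.1 h))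
      rw [comm, this.eq, sub_self]
  rw [h1, h2, ← Finset.sum_fiberwise _ (fun p : Finset Λ × Finset Λ => p.1 ∪ p.2), total]
  refine Finset.sum_congr rfl fun S _ => ?_
  rw [adPot, Finset.filter_filter]
  simp only [and_comm]

/-- A set meeting `S` contains one of its points, so a union bound over those points costs the
factor `|S|`. -/
theorem sum_intersecting_pairs_le (f h : Finset Λ → ℝ) (hf : ∀ S, 0 ≤ f S) (hh : ∀ S, 0 ≤ h S)
    (b : ℝ) (hb : ∀ j, ∑ T : Finset Λ with j ∈ T, h T ≤ b) (i : Λ) :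
    ∑ p : Finset Λ × Finset Λ with (p.1 ∩ p.2).Nonempty ∧ i ∈ p.1, f p.1 * h p.2 ≤
      ∑ S : Finset Λ with i ∈ S, f S * ((S.card : ℝ) * b) := by
  rw [Finset.sum_filter, Finset.sum_filter, Fintype.sum_prod_type]
  refine Finset.sum_le_sum fun S _ => ?_
  by_cases hi : i ∈ S
  · simp only [hi, and_true, if_true]
    have h1 : ∀ T : Finset Λ, (if (S ∩ T).Nonempty then f S * h T else 0) ≤
        f S * ∑ j ∈ S, if j ∈ T then h T else 0 := by
      intro T
      have hnn : ∀ j ∈ S, 0 ≤ if j ∈ T then h T else 0 := fun j _ => by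
        split_ifs
        · exact hh T
        · exact le_rfl
      split_ifs with hT
      · obtain ⟨j, hj⟩ := hT
        rw [Finset.mem_inter] at hj
        refine mul_le_mul_of_nonneg_left ?_ (hf S)
        refine le_trans ?_ (Finset.single_le_sum hnn hj.1)
        simp [hj.2]
      · exact mul_nonneg (hf S) (Finset.sum_nonneg hnn)
    refine (Finset.sum_le_sum fun T _ => h1 T).trans ?_
    rw [← Finset.mul_sum, Finset.sum_comm]
    refine mul_le_mul_of_nonneg_left ?_ (hf S)
    rw [← nsmul_eq_mul]
    refine Finset.sum_le_card_nsmul _ _ _ fun j _ => ?_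
    rw [← Finset.sum_filter]
    exact hb j
  · simp [hi]

/-- The loss `δ` of rate pays for a factor `|S|`, because `y ≤ e^(y-1) ≤ e^y / 2`. -/
theorem mul_exp_sub_le {κ δ s : ℝ} (hδ : 0 < δ) :
    s * Real.exp ((κ - δ) * s) ≤ Real.exp (κ * s) / (2 * δ) := by
  have h1 : δ * s ≤ Real.exp (δ * s) / 2 := by
    have h := Real.add_one_le_exp (δ * s - 1)
    rw [Real.exp_sub] at h
    have h2 : Real.exp (δ * s) / Real.exp 1 ≤ Real.exp (δ * s) / 2 := by
      gcongr
      linarith [Real.add_one_le_exp (1 : ℝ)]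
    linarith
  have h3 : Real.exp (κ * s) = Real.exp ((κ - δ) * s) * Real.exp (δ * s) := by
    rw [← Real.exp_add]; ring_nf
  rw [h3, le_div_iff₀ (by positivity)]
  nlinarith [Real.exp_pos ((κ - δ) * s)]

/-- A site of the union lies in the set of `A` or in that of `G`. The constant is `2` from the
commutator, `2` from these cases and `1/(2δ)` from the loss of rate. -/
theorem LocBound.adPot {κ δ a b : ℝ} {A G : Finset Λ → Op Λ d} (hA : LocBound κ A a)
    (hG : LocBound κ G b) (hδ : 0 < δ) (hκ : δ ≤ κ) (ha : 0 ≤ a) (hb : 0 ≤ b) :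
    LocBound (κ - δ) (adPot A G) (2 * a / δ * b) := by
  intro i
  set w := κ - δ with hw
  have hw0 : 0 ≤ w := by linarith
  set f : Finset Λ → ℝ := fun S => Real.exp (w * S.card) * ‖A S‖ with hf
  set h : Finset Λ → ℝ := fun S => Real.exp (w * S.card) * ‖G S‖ with hh
  have hf0 : ∀ S, 0 ≤ f S := fun S => by positivity
  have hh0 : ∀ S, 0 ≤ h S := fun S => by positivity
  have hterm : ∀ p : Finset Λ × Finset Λ,
      Real.exp (w * ((p.1 ∪ p.2).card : ℝ)) * ‖comm (A p.1) (G p.2)‖ ≤ 2 * (f p.1 * h p.2) := by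
    intro p
    have h1 : Real.exp (w * ((p.1 ∪ p.2).card : ℝ)) ≤
        Real.exp (w * p.1.card) * Real.exp (w * p.2.card) := by
      rw [← Real.exp_add, ← mul_add]
      gcongr
      exact_mod_cast Finset.card_union_le _ _
    calc _ ≤ (Real.exp (w * p.1.card) * Real.exp (w * p.2.card)) * (2 * ‖A p.1‖ * ‖G p.2‖) :=
          mul_le_mul h1 (norm_comm_le _ _) (norm_nonneg _) (by positivity)
      _ = _ := by simp only [hf, hh]; ring
  have hw' : w ≤ κ := by linarith
  have hfb : ∀ j, ∑ T : Finset Λ with j ∈ T, f T ≤ a := hA.mono hw' le_rfl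
  have hhb : ∀ j, ∑ T : Finset Λ with j ∈ T, h T ≤ b := hG.mono hw' le_rfl
  have hsum : ∀ (K : Finset Λ → Op Λ d) (k c : ℝ), LocBound κ K k → 0 ≤ c →
      ∑ S : Finset Λ with i ∈ S, (Real.exp (w * S.card) * ‖K S‖) * ((S.card : ℝ) * c) ≤
        k * c / (2 * δ) := by
    intro K k c hK hc
    calc _ ≤ ∑ S : Finset Λ with i ∈ S, (Real.exp (κ * S.card) * ‖K S‖) * (c / (2 * δ)) := by
          refine Finset.sum_le_sum fun S _ => ?_
          have := mul_exp_sub_le (κ := κ) (s := S.card) hδ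
          calc _ = ((S.card : ℝ) * Real.exp ((κ - δ) * S.card)) * (‖K S‖ * c) := by rw [hw]; ring
            _ ≤ (Real.exp (κ * S.card) / (2 * δ)) * (‖K S‖ * c) := by gcongr
            _ = _ := by ring
      _ ≤ k * (c / (2 * δ)) := by
          rw [← Finset.sum_mul]
          gcongr
          exact hK i
      _ = _ := by ring
  calc ∑ S : Finset Λ with i ∈ S, Real.exp (w * (S.card : ℝ)) * ‖SpinSystem.adPot A G S‖
      ≤ ∑ S : Finset Λ with i ∈ S,
          ∑ p : Finset Λ × Finset Λ with p.1 ∪ p.2 = S ∧ (p.1 ∩ p.2).Nonempty,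
            2 * (f p.1 * h p.2) := by
        refine Finset.sum_le_sum fun S _ => ?_
        refine (mul_le_mul_of_nonneg_left (norm_sum_le _ _) (Real.exp_pos _).le).trans ?_
        rw [Finset.mul_sum]
        refine Finset.sum_le_sum fun p hp => ?_
        simp only [Finset.mem_filter, Finset.mem_univ, true_and] at hp
        rw [← hp.1]
        exact hterm p
    _ = ∑ p : Finset Λ × Finset Λ with (p.1 ∩ p.2).Nonempty ∧ i ∈ p.1 ∪ p.2,
          2 * (f p.1 * h p.2) := by
        simp only [Finset.sum_filter]
        have : ∀ S : Finset Λ, (if i ∈ S then ∑ p : Finset Λ × Finset Λ,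
            if p.1 ∪ p.2 = S ∧ (p.1 ∩ p.2).Nonempty then 2 * (f p.1 * h p.2) else 0 else 0) =
            ∑ p : Finset Λ × Finset Λ, if p.1 ∪ p.2 = S then
              (if (p.1 ∩ p.2).Nonempty ∧ i ∈ p.1 ∪ p.2 then 2 * (f p.1 * h p.2) else 0) else 0 := by
          intro S
          by_cases hi : i ∈ S
          · simp only [hi, if_true]
            refine Finset.sum_congr rfl fun p _ => ?_
            by_cases hp : p.1 ∪ p.2 = S
            · simp [hp, hi]
            · simp [hp]
          · simp only [hi, if_false]
            symm
            refine Finset.sum_eq_zero fun p _ => ?_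
            by_cases hp : p.1 ∪ p.2 = S
            · simp [hp, hi]
            · simp [hp]
        rw [Finset.sum_congr rfl fun S _ => this S, Finset.sum_comm]
        refine Finset.sum_congr rfl fun p _ => ?_
        simp
    _ ≤ ∑ p : Finset Λ × Finset Λ with (p.1 ∩ p.2).Nonempty ∧ i ∈ p.1, 2 * (f p.1 * h p.2) +
        ∑ p : Finset Λ × Finset Λ with (p.1 ∩ p.2).Nonempty ∧ i ∈ p.2, 2 * (f p.1 * h p.2) := by
        simp only [Finset.sum_filter]
        rw [← Finset.sum_add_distrib]
        refine Finset.sum_le_sum fun p _ => ?_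
        have : 0 ≤ 2 * (f p.1 * h p.2) := mul_nonneg zero_le_two (mul_nonneg (hf0 _) (hh0 _))
        by_cases h1 : i ∈ p.1 <;> by_cases h2 : i ∈ p.2 <;>
          by_cases h3 : (p.1 ∩ p.2).Nonempty <;> simp [h1, h2, h3, this]
    _ ≤ 2 * (a * b / (2 * δ)) + 2 * (b * a / (2 * δ)) := by
        refine add_le_add ?_ ?_
        · rw [← Finset.mul_sum]
          gcongr
          exact (sum_intersecting_pairs_le f h hf0 hh0 b hhb i).trans (hsum A a b hA hb)
        · rw [← Finset.mul_sum]
          gcongr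
          refine le_trans (le_of_eq ?_)
            ((sum_intersecting_pairs_le h f hh0 hf0 a hfb i).trans (hsum G b a hG ha))
          refine Finset.sum_equiv (Equiv.prodComm _ _) ?_ ?_
          · intro p
            simp [Finset.inter_comm]
          · intro p _
            simp [mul_comm]
    _ = 2 * a / δ * b := by field_simp; ring

/-- Each of the `k` commutators gives up `δ/k` of the rate. The resulting `k^k` is at most `k! 3^k`,
and the exponential series cancels the factorial. -/
theorem LocBound.adPot_iterate {κ δ a b : ℝ} {A G : Finset Λ → Op Λ d} (hA : LocBound κ A a)
    (hG : LocBound κ G b) (hδ : 0 < δ) (hκ : δ ≤ κ) (ha : 0 ≤ a) (hb : 0 ≤ b) (k : ℕ) :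
    LocBound (κ - δ) ((SpinSystem.adPot A)^[k] G) (k.factorial * (6 * a / δ) ^ k * b) := by
  rcases Nat.eq_zero_or_pos k with rfl | hk
  · simpa using hG.mono (by linarith) le_rfl
  have hk' : (0 : ℝ) < k := by exact_mod_cast hk
  set η := δ / k with hη
  have hη0 : 0 < η := by positivity
  have hkη : k * η = δ := by rw [hη]; field_simp
  have key : ∀ j : ℕ, j ≤ k →
      LocBound (κ - j * η) ((SpinSystem.adPot A)^[j] G) ((2 * a / η) ^ j * b) := by
    intro j
    induction j with
    | zero => intro _; simpa using hG
    | succ j ih =>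
      intro hj
      have h1 := ih (by omega)
      have h2 : ((j + 1 : ℕ) : ℝ) * η ≤ k * η := by gcongr
      push_cast at h2
      have h3 := (hA.mono (show κ - j * η ≤ κ by nlinarith [Nat.cast_nonneg (α := ℝ) j]) le_rfl).adPot
        h1 hη0 (by linarith) ha (by positivity)
      rw [Function.iterate_succ_apply']
      refine h3.mono (le_of_eq (by push_cast; ring)) (le_of_eq (by ring))
  refine (key k le_rfl).mono (by linarith) ?_
  gcongr
  have h1 := Real.pow_div_factorial_le_exp (k : ℝ) hk'.le k
  have h2 : Real.exp k ≤ 3 ^ k := by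
    rw [← Real.exp_one_pow]
    gcongr
    exact Real.exp_one_lt_three.le
  have h3 : (k : ℝ) ^ k ≤ k.factorial * 3 ^ k := by
    have hf : (0 : ℝ) < k.factorial := by positivity
    rw [div_le_iff₀ hf] at h1
    nlinarith
  calc (2 * a / η) ^ k = (2 * a / δ) ^ k * (k : ℝ) ^ k := by
        rw [← mul_pow, hη]; congr 1; field_simp
    _ ≤ (2 * a / δ) ^ k * (k.factorial * 3 ^ k) := by gcongr
    _ = k.factorial * (6 * a / δ) ^ k := by
        rw [mul_left_comm, ← mul_pow]; congr 2; ring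

end LocalBounds

/-! ### Commutator series as potentials -/

section Series

variable {Λ : Type*} [Fintype Λ] [DecidableEq Λ] {d q : ℕ}

theorem IsPotential.adPot_iterate {𝒢 : SimpleGraph Λ} {N : Fin q → Finset Λ → Op Λ d}
    {A G : Finset Λ → Op Λ d} (hA : IsPotential 𝒢 N A) (hG : IsPotential 𝒢 N G) (k : ℕ) :
    IsPotential 𝒢 N ((SpinSystem.adPot A)^[k] G) ∧
      total ((SpinSystem.adPot A)^[k] G) = (comm (total A))^[k] (total G) := by
  induction k with
  | zero => exact ⟨hG, rfl⟩
  | succ k ih =>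
    rw [Function.iterate_succ_apply', Function.iterate_succ_apply', ← ih.2]
    exact ⟨hA.adPot ih.1, total_adPot hA ih.1⟩

theorem isSelfAdjoint_comm {a x : Op Λ d} (ha : star a = -a) (hx : IsSelfAdjoint x) :
    IsSelfAdjoint (comm a x) := by
  rw [isSelfAdjoint_iff, comm, star_sub, star_mul, star_mul, ha, hx.star_eq]
  noncomm_ring

theorem isSelfAdjoint_adPot_iterate {A G : Finset Λ → Op Λ d} (hA : ∀ S, star (A S) = -A S)
    (hG : ∀ S, IsSelfAdjoint (G S)) (k : ℕ) (S : Finset Λ) :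
    IsSelfAdjoint ((adPot A)^[k] G S) := by
  induction k generalizing S with
  | zero => exact hG S
  | succ k ih =>
    rw [Function.iterate_succ_apply', adPot, isSelfAdjoint_iff, star_sum]
    exact Finset.sum_congr rfl fun p _ => (isSelfAdjoint_comm (hA _) (ih _)).star_eq

theorem tsum_geometric_succ_le {r : ℝ} (hr : 0 ≤ r) (hr' : r ≤ 1 / 2) :
    Summable (fun k : ℕ => r ^ (k + 1)) ∧ ∑' k : ℕ, r ^ (k + 1) ≤ 2 * r := by
  have hs : Summable (fun k : ℕ => r ^ k) := summable_geometric_of_lt_one hr (by linarith)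
  refine ⟨by simpa [pow_succ] using hs.mul_right r, ?_⟩
  simp only [pow_succ]
  rw [hs.tsum_mul_right, tsum_geometric_of_lt_one hr (by linarith)]
  have : (1 - r)⁻¹ ≤ 2 := by
    rw [inv_le_comm₀ (by linarith) (by norm_num)]; linarith
  gcongr

/-- Power series in the commutator with a small potential, without constant term. -/
theorem exists_potential_series {𝒢 : SimpleGraph Λ} {N : Fin q → Finset Λ → Op Λ d}
    {A G : Finset Λ → Op Λ d} {κ δ a b : ℝ} (hA : IsPotential 𝒢 N A) (hG : IsPotential 𝒢 N G)
    (hAb : LocBound κ A a) (hGb : LocBound κ G b) (hδ : 0 < δ) (hκ : δ ≤ κ) (ha : 0 ≤ a)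
    (hb : 0 ≤ b) (hsmall : 12 * a ≤ δ) (c : ℕ → ℝ) (hc : ∀ k, |c k| ≤ ((k.factorial : ℝ))⁻¹) :
    ∃ K : Finset Λ → Op Λ d, IsPotential 𝒢 N K ∧ LocBound (κ - δ) K (12 * a / δ * b) ∧
      HasSum (fun k : ℕ => (c (k + 1) : ℂ) • (comm (total A))^[k + 1] (total G)) (total K) ∧
      ((∀ S, star (A S) = -A S) → (∀ S, IsSelfAdjoint (G S)) → ∀ S, IsSelfAdjoint (K S)) := by
  set T : ℕ → Finset Λ → Op Λ d := fun k S => (c (k + 1) : ℂ) • (adPot A)^[k + 1] G S with hT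
  -- The factorials cancel against `c`, leaving a geometric series of ratio `r ≤ 1/2`, with sum at
  -- most `2r = 12a/δ`.
  set r := 6 * a / δ with hr
  have hr0 : 0 ≤ r := by positivity
  have hr1 : r ≤ 1 / 2 := by rw [hr, div_le_iff₀ hδ]; linarith
  obtain ⟨hgs, hgle⟩ := tsum_geometric_succ_le hr0 hr1
  have hTb : ∀ k, LocBound (κ - δ) (T k) (r ^ (k + 1) * b) := by
    intro k i
    have h1 := hAb.adPot_iterate hGb hδ hκ ha hb (k + 1) i
    have hf : (0 : ℝ) < (k + 1).factorial := by positivity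
    calc _ = |c (k + 1)| * ∑ S : Finset Λ with i ∈ S,
          Real.exp ((κ - δ) * (S.card : ℝ)) * ‖(adPot A)^[k + 1] G S‖ := by
          rw [Finset.mul_sum]
          refine Finset.sum_congr rfl fun S _ => ?_
          simp only [hT]
          rw [norm_smul, Complex.norm_real, Real.norm_eq_abs]
          ring
      _ ≤ ((k + 1).factorial : ℝ)⁻¹ * ((k + 1).factorial * r ^ (k + 1) * b) :=
          mul_le_mul (hc _) h1 (Finset.sum_nonneg fun _ _ => by positivity) (by positivity)
      _ = _ := by field_simp
  have hTe : ∀ k, T k ∅ = 0 := fun k => by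
    simp only [hT]; rw [Function.iterate_succ_apply', adPot_empty, smul_zero]
  have hsn : ∀ S, Summable fun k => ‖T k S‖ := by
    intro S
    rcases S.eq_empty_or_nonempty with rfl | hS
    · simp only [hTe, norm_zero]; exact summable_zero
    · exact (hgs.mul_right b).of_nonneg_of_le (fun _ => norm_nonneg _) fun k =>
        (hTb k).norm_le (by linarith) hS
  have hs : ∀ S, Summable fun k => T k S := fun S => (hsn S).of_norm
  refine ⟨fun S => ∑' k, T k S, ?_, ?_, ?_, ?_⟩
  · have hTp : ∀ k, IsPotential 𝒢 N (T k) := fun k =>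
      (hA.adPot_iterate hG (k + 1)).1.smul (c (k + 1) : ℂ)
    refine isPotential_of_mem (fun S => ?_) fun S hS => ?_
    · exact (isClosed_strongAlgebra N S).mem_of_tendsto (hs S).hasSum
        (Filter.Eventually.of_forall fun s => sum_mem fun k _ => (hTp k).mem S)
    · simp [(hTp _).eq_zero S hS]
  · intro i
    calc ∑ S : Finset Λ with i ∈ S, Real.exp ((κ - δ) * (S.card : ℝ)) * ‖∑' k, T k S‖
        ≤ ∑ S : Finset Λ with i ∈ S, ∑' k, Real.exp ((κ - δ) * (S.card : ℝ)) * ‖T k S‖ := by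
          refine Finset.sum_le_sum fun S _ => ?_
          rw [(hsn S).tsum_mul_left]
          gcongr
          exact norm_tsum_le_tsum_norm (hsn S)
      _ = ∑' k, ∑ S : Finset Λ with i ∈ S, Real.exp ((κ - δ) * (S.card : ℝ)) * ‖T k S‖ :=
          (Summable.tsum_finsetSum fun S _ => (hsn S).mul_left _).symm
      _ ≤ ∑' k, r ^ (k + 1) * b :=
          Summable.tsum_le_tsum (fun k => hTb k i)
            (summable_sum fun S _ => (hsn S).mul_left _) (hgs.mul_right b)
      _ ≤ 2 * r * b := by
          rw [hgs.tsum_mul_right]; gcongr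
      _ = _ := by rw [hr]; ring
  · have h1 : HasSum (fun k => ∑ S, T k S) (∑ S, ∑' k, T k S) :=
      hasSum_sum fun S _ => (hs S).hasSum
    have h2 : (fun k : ℕ => (c (k + 1) : ℂ) • (comm (total A))^[k + 1] (total G)) =
        fun k => ∑ S, T k S := by
      funext k
      rw [← (hA.adPot_iterate hG (k + 1)).2, total, Finset.smul_sum]
    rw [h2]
    exact h1
  · intro hAs hGs S
    have : ∀ k, IsSelfAdjoint (T k S) := fun k => by
      have := isSelfAdjoint_adPot_iterate hAs hGs (k + 1) S
      rw [isSelfAdjoint_iff] at this ⊢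
      simp only [hT]
      rw [star_smul, this]
      simp
    rw [isSelfAdjoint_iff, tsum_star]
    exact tsum_congr fun k => (this k).star_eq

/-- Conjugation of a potential by the exponential of a small skew-adjoint potential. -/
theorem exists_potential_conj {𝒢 : SimpleGraph Λ} {N : Fin q → Finset Λ → Op Λ d}
    {A G : Finset Λ → Op Λ d} {κ δ a b : ℝ} (hA : IsPotential 𝒢 N A) (hG : IsPotential 𝒢 N G)
    (hAb : LocBound κ A a) (hGb : LocBound κ G b) (hδ : 0 < δ) (hκ : δ ≤ κ) (ha : 0 ≤ a)
    (hb : 0 ≤ b) (hsmall : 12 * a ≤ δ) :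
    ∃ K : Finset Λ → Op Λ d, IsPotential 𝒢 N K ∧ LocBound (κ - δ) K (12 * a / δ * b) ∧
      total K = NormedSpace.exp (total A) * total G * NormedSpace.exp (-total A) - total G ∧
      ((∀ S, star (A S) = -A S) → (∀ S, IsSelfAdjoint (G S)) → ∀ S, IsSelfAdjoint (K S)) := by
  obtain ⟨K, h1, h2, h3, h4⟩ := exists_potential_series hA hG hAb hGb hδ hκ ha hb hsmall
    (fun k => ((k.factorial : ℝ))⁻¹) fun k => by rw [abs_of_nonneg (by positivity)]
  refine ⟨K, h1, h2, h3.unique ?_, h4⟩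
  have := (hasSum_nat_add_iff' 1).2 (hasSum_comm_iterate (total A) (total G))
  simpa using this

/-- Conjugation of an operator whose commutator with a small skew-adjoint potential is given by a
potential. -/
theorem exists_potential_conj_of_comm {𝒢 : SimpleGraph Λ} {N : Fin q → Finset Λ → Op Λ d}
    {A F : Finset Λ → Op Λ d} {X : Op Λ d} {κ δ a b : ℝ} (hA : IsPotential 𝒢 N A)
    (hF : IsPotential 𝒢 N F) (hX : comm (total A) X = total F)
    (hAb : LocBound κ A a) (hFb : LocBound κ F b) (hδ : 0 < δ) (hκ : δ ≤ κ) (ha : 0 ≤ a)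
    (hb : 0 ≤ b) (hsmall : 12 * a ≤ δ) :
    ∃ K : Finset Λ → Op Λ d, IsPotential 𝒢 N K ∧ LocBound (κ - δ) K (12 * a / δ * b) ∧
      NormedSpace.exp (total A) * X * NormedSpace.exp (-total A) = X + total F + total K ∧
      ((∀ S, star (A S) = -A S) → (∀ S, IsSelfAdjoint (F S)) → ∀ S, IsSelfAdjoint (K S)) := by
  -- `X` need not be given by a potential, but its first commutator is `F`. The order `k + 1` term
  -- for `X` is the order `k` term for `F`, with weight `1/(k+1)!`.
  obtain ⟨K, h1, h2, h3, h4⟩ := exists_potential_series hA hF hAb hFb hδ hκ ha hb hsmall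
    (fun k => (((k + 1).factorial : ℝ))⁻¹) fun k => by
      rw [abs_of_nonneg (by positivity)]
      gcongr
      omega
  refine ⟨K, h1, h2, ?_, h4⟩
  have h5 := (hasSum_nat_add_iff' 2).2 (hasSum_comm_iterate (total A) X)
  have h6 : (fun n : ℕ => (((n + 2).factorial : ℂ)⁻¹) • (comm (total A))^[n + 2] X) =
      fun k : ℕ => ((((k + 1 + 1).factorial : ℝ)⁻¹ : ℝ) : ℂ) •
        (comm (total A))^[k + 1] (total F) := by
    funext k
    rw [← hX, ← Function.iterate_succ_apply]
    simp
  rw [h6] at h5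
  have h7 := h3.unique h5
  rw [h7]
  simp [Finset.sum_range_succ, hX]

end Series

/-! ### Joint diagonalization and Schur multipliers -/

section Diagonalization

variable {ι : Type*} [Fintype ι] [DecidableEq ι]

/-- A commuting family of Hermitian matrices is diagonalized by a unitary matrix. -/
theorem exists_unitary_diagonalization {β : Type*} (T : β → Matrix ι ι ℂ)
    (hT : ∀ k, IsSelfAdjoint (T k)) (hc : ∀ k l, Commute (T k) (T l)) :
    ∃ U ∈ unitary (Matrix ι ι ℂ), ∃ n : β → ι → ℂ,
      ∀ k, T k = U * Matrix.diagonal (n k) * star U := by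
  classical
  set L : β → (EuclideanSpace ℂ ι →ₗ[ℂ] EuclideanSpace ℂ ι) := fun k => (T k).toEuclideanLin with hL
  have hLs : ∀ k, (L k).IsSymmetric := fun k => Matrix.isSymmetric_toEuclideanLin_iff.2 (hT k)
  have hLc : Pairwise (Function.onFun Commute L) := by
    intro k l _
    have h1 : ∀ k l, L k * L l = (T k * T l).toEuclideanLin := by
      intro k l
      ext v : 1
      simp [hL, Matrix.toEuclideanLin, Matrix.toLpLin, Matrix.mulVec_mulVec]
    change L k * L l = L l * L k
    rw [h1, h1, (hc k l).eq]
  have hI := LinearMap.IsSymmetric.directSum_isInternal_of_pairwise_commute hLs hLc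
  have hO := LinearMap.IsSymmetric.orthogonalFamily_iInf_eigenspaces hLs
  set B := hI.collectedBasis fun χ => (stdOrthonormalBasis ℂ
    (⨅ j, Module.End.eigenspace (L j) (χ j) : Submodule ℂ (EuclideanSpace ℂ ι))).toBasis with hB
  have hBo : Orthonormal ℂ B := DirectSum.IsInternal.collectedBasis_orthonormal hO hI fun χ => by
    simp
  let _ : Fintype (Σ χ : β → ℂ, Fin (Module.finrank ℂ
      (⨅ j, Module.End.eigenspace (L j) (χ j) : Submodule ℂ (EuclideanSpace ℂ ι)))) :=
    FiniteDimensional.fintypeBasisIndex B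
  have hcard := Module.finrank_eq_card_basis B
  rw [finrank_euclideanSpace] at hcard
  let e := Fintype.equivOfCardEq hcard
  let b : OrthonormalBasis ι ℂ (EuclideanSpace ℂ ι) := (B.toOrthonormalBasis hBo).reindex e.symm
  have hb : ∀ a k, L k (b a) = (e a).1 k • b a := by
    intro a k
    have h1 : b a = B (e a) := by simp [b]
    have h2 := hI.collectedBasis_mem (fun χ => (stdOrthonormalBasis ℂ
      (⨅ j, Module.End.eigenspace (L j) (χ j) : Submodule ℂ (EuclideanSpace ℂ ι))).toBasis) (e a)
    rw [← hB, ← h1] at h2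
    exact Module.End.mem_eigenspace_iff.1 ((Submodule.mem_iInf _).1 h2 k)
  set U : Matrix ι ι ℂ := (EuclideanSpace.basisFun ι ℂ).toBasis.toMatrix b with hU
  have hUu : U ∈ unitary (Matrix ι ι ℂ) :=
    (EuclideanSpace.basisFun ι ℂ).toMatrix_orthonormalBasis_mem_unitary b
  have hUa : ∀ i j, U i j = b j i := fun i j => by
    simp [hU, Module.Basis.toMatrix_apply]
  refine ⟨U, hUu, fun k a => (e a).1 k, fun k => ?_⟩
  have h1 : T k * U = U * Matrix.diagonal fun a => (e a).1 k := by
    ext i j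
    rw [Matrix.mul_diagonal, Matrix.mul_apply, hUa]
    have h2 := congrArg (fun v : EuclideanSpace ℂ ι => v i) (hb j k)
    simp only [hL, PiLp.smul_apply, smul_eq_mul] at h2
    rw [mul_comm, ← h2]
    simp only [hUa]
    simp [Matrix.toEuclideanLin, Matrix.toLpLin, Matrix.mulVec, dotProduct]
  rw [← h1, mul_assoc, (Unitary.mem_iff.1 hUu).2, mul_one]

/-- Restricting a matrix to the entries with `r a = c b` does not increase its norm. -/
theorem norm_mask_le {β : Type*} [DecidableEq β] (X : Matrix ι ι ℂ) (r c : ι → β) :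
    ‖(Matrix.of fun a b => if r a = c b then X a b else 0 : Matrix ι ι ℂ)‖ ≤ ‖X‖ := by
  set M : Matrix ι ι ℂ := Matrix.of fun a b => if r a = c b then X a b else 0 with hM
  rw [Matrix.cstar_norm_def M]
  refine ContinuousLinearMap.opNorm_le_bound _ (norm_nonneg _) fun v => ?_
  refine le_of_sq_le_sq ?_ (by positivity)
  -- Row `a` of the masked matrix sees only the piece `w (r a)` of `v`, and distinct pieces have
  -- disjoint supports, so their squared norms add up to at most that of `v`.
  let w : β → EuclideanSpace ℂ ι := fun k => WithLp.toLp 2 fun b => if k = c b then v b else 0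
  have h1 : ∀ a, (Matrix.toEuclideanCLM (n := ι) (𝕜 := ℂ) M v) a =
      (Matrix.toEuclideanCLM (n := ι) (𝕜 := ℂ) X (w (r a))) a := by
    intro a
    rw [Matrix.ofLp_toEuclideanCLM, Matrix.ofLp_toEuclideanCLM]
    simp only [Matrix.mulVec, dotProduct, hM, Matrix.of_apply, w]
    refine Finset.sum_congr rfl fun b _ => ?_
    split_ifs <;> simp
  rw [EuclideanSpace.norm_sq_eq]
  set s := Finset.univ.image r
  calc ∑ a, ‖(Matrix.toEuclideanCLM (n := ι) (𝕜 := ℂ) M v) a‖ ^ 2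
      = ∑ k ∈ s, ∑ a with r a = k,
          ‖(Matrix.toEuclideanCLM (n := ι) (𝕜 := ℂ) X (w k)) a‖ ^ 2 := by
        rw [← Finset.sum_fiberwise_of_maps_to (t := s) (g := r)
          fun a _ => Finset.mem_image_of_mem r (Finset.mem_univ a)]
        refine Finset.sum_congr rfl fun k _ => Finset.sum_congr rfl fun a ha => ?_
        rw [h1 a, (Finset.mem_filter.1 ha).2]
    _ ≤ ∑ k ∈ s, ‖Matrix.toEuclideanCLM (n := ι) (𝕜 := ℂ) X (w k)‖ ^ 2 := by
        refine Finset.sum_le_sum fun k _ => ?_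
        rw [EuclideanSpace.norm_sq_eq]
        exact Finset.sum_le_sum_of_subset_of_nonneg (Finset.subset_univ _)
          fun _ _ _ => by positivity
    _ ≤ ∑ k ∈ s, ‖X‖ ^ 2 * ‖w k‖ ^ 2 := by
        refine Finset.sum_le_sum fun k _ => ?_
        rw [← mul_pow]
        gcongr
        rw [Matrix.cstar_norm_def X]
        exact ContinuousLinearMap.le_opNorm _ _
    _ ≤ (‖X‖ * ‖v‖) ^ 2 := by
        rw [← Finset.mul_sum, mul_pow]
        gcongr
        simp_rw [EuclideanSpace.norm_sq_eq]
        rw [Finset.sum_comm]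
        refine Finset.sum_le_sum fun b _ => ?_
        have : ∀ k, ‖(w k) b‖ ^ 2 = if k = c b then ‖v b‖ ^ 2 else 0 := by
          intro k; simp only [w]; split_ifs <;> simp
        simp only [this, Finset.sum_ite_eq']
        split_ifs
        · exact le_rfl
        · positivity

variable {q : ℕ}

/-- The matrix with entries `f (n a - n b) X a b`. -/
def schur (f : (Fin q → ℤ) → ℝ) (n : ι → Fin q → ℤ) (X : Matrix ι ι ℂ) : Matrix ι ι ℂ :=
  Matrix.of fun a b => (f (n a - n b) : ℂ) * X a b

/-- The multiplier splits according to the value `m` of `n a - n b`, and each part is a masked copy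
of `X`. The cost is a sum of `|f m|`, independent of the matrix size. -/
theorem norm_schur_le (f : (Fin q → ℤ) → ℝ) (n : ι → Fin q → ℤ) (X : Matrix ι ι ℂ)
    (F : Finset (Fin q → ℤ)) (hF : ∀ a b, f (n a - n b) ≠ 0 → n a - n b ∈ F) :
    ‖schur f n X‖ ≤ (∑ m ∈ F, |f m|) * ‖X‖ := by
  have h : schur f n X = ∑ m ∈ F, (f m : ℂ) •
      (Matrix.of fun a b => if n a = n b + m then X a b else 0 : Matrix ι ι ℂ) := by
    ext a b
    rw [Matrix.sum_apply]
    simp only [schur, Matrix.of_apply, Matrix.smul_apply, smul_eq_mul, mul_ite, mul_zero]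
    have : ∀ m, (n a = n b + m) ↔ (n a - n b = m) := fun m => by
      rw [sub_eq_iff_eq_add']
    simp only [this, Finset.sum_ite_eq]
    split_ifs with hm
    · rfl
    · have : f (n a - n b) = 0 := by
        by_contra h'; exact hm (hF a b h')
      simp [this]
  rw [h, Finset.sum_mul]
  refine (norm_sum_le _ _).trans (Finset.sum_le_sum fun m _ => ?_)
  rw [norm_smul, Complex.norm_real, Real.norm_eq_abs]
  gcongr
  exact norm_mask_le X n fun b => n b + m

theorem star_schur (f : (Fin q → ℤ) → ℝ) (n : ι → Fin q → ℤ) (X : Matrix ι ι ℂ) :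
    star (schur f n X) = schur (fun m => f (-m)) n (star X) := by
  ext a b
  simp [schur, Matrix.star_apply]

/-- `B` does not change `n`, so the multiplier factors out of both products. This keeps Schur
multiples strongly supported. -/
theorem commute_schur {f : (Fin q → ℤ) → ℝ} {n : ι → Fin q → ℤ} {X B : Matrix ι ι ℂ}
    (hB : ∀ a b, B a b ≠ 0 → n a = n b) (h : Commute B X) : Commute B (schur f n X) := by
  ext a b
  have h1 : (B * schur f n X) a b = (f (n a - n b) : ℂ) * (B * X) a b := by
    rw [Matrix.mul_apply, Matrix.mul_apply, Finset.mul_sum]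
    refine Finset.sum_congr rfl fun c _ => ?_
    by_cases hc : B a c = 0
    · simp [hc]
    · rw [hB a c hc]; simp only [schur, Matrix.of_apply]; ring
  have h2 : (schur f n X * B) a b = (f (n a - n b) : ℂ) * (X * B) a b := by
    rw [Matrix.mul_apply, Matrix.mul_apply, Finset.mul_sum]
    refine Finset.sum_congr rfl fun c _ => ?_
    by_cases hc : B c b = 0
    · simp [hc]
    · rw [← hB c b hc]; simp only [schur, Matrix.of_apply]; ring
  rw [h1, h2, h.eq]

/-- Commutators with charges become multiplication of symbols, which turns the homological equation
into a scalar division. -/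
theorem comm_diagonal_schur (f : (Fin q → ℤ) → ℝ) (n : ι → Fin q → ℤ) (X : Matrix ι ι ℂ)
    (α : Fin q) : comm (schur f n X) (Matrix.diagonal fun a => ((n a α : ℤ) : ℂ)) =
      schur (fun m => -(m α : ℝ) * f m) n X := by
  ext a b
  simp only [comm, Matrix.sub_apply, Matrix.mul_diagonal, Matrix.diagonal_mul, schur,
    Matrix.of_apply, Pi.sub_apply]
  push_cast
  ring

end Diagonalization

/-! ### Local charges and the homological equation -/

section Charges

variable {Λ : Type*} [Fintype Λ] [DecidableEq Λ] {d q : ℕ}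

theorem supportedIn_univ (O : Op Λ d) : SupportedIn Finset.univ O :=
  ⟨fun s s' => O (fun i => s ⟨i, Finset.mem_univ i⟩) (fun i => s' ⟨i, Finset.mem_univ i⟩),
    fun σ σ' => by simp⟩

/-- The part of the charge `α` inside `S`. -/
noncomputable def innerCharge (N : Fin q → Finset Λ → Op Λ d) (α : Fin q) (S : Finset Λ) : Op Λ d :=
  ∑ S' : Finset Λ with S'.Nonempty ∧ S' ⊆ S, N α S'

variable {𝒢 : SimpleGraph Λ} {R : ℕ} {γ : ℝ} {N : Fin q → Finset Λ → Op Λ d}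

theorem comm_eq_zero {A B : Op Λ d} (h : Commute A B) : comm A B = 0 := by
  rw [comm, h.eq, sub_self]

/-- Strong support removes the charges that leave `S`. The term at `∅`, which the local bound does
not control, drops out because it commutes with everything. -/
theorem comm_total_charge (hN : IsChargeFamily 𝒢 R γ N) {S : Finset Λ} {X : Op Λ d}
    (hX : X ∈ strongAlgebra N S) (α : Fin q) :
    comm X (total (N α)) = comm X (innerCharge N α S) := by
  rw [total, innerCharge, comm_sum_right, comm_sum_right, Finset.sum_filter]
  refine Finset.sum_congr rfl fun S' _ => ?_
  split_ifs with h
  · rfl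
  · rcases S'.eq_empty_or_nonempty with rfl | hne
    · exact comm_eq_zero ((supportedIn_univ X).commute_of_disjoint (hN.supported α ∅)
        (Finset.disjoint_empty_right _))
    · exact comm_eq_zero ((mem_strongAlgebra.1 hX).2 α S' fun h' => h ⟨hne, h'⟩)

/-- Each nonempty set is charged to one of its sites. This bounds the integer frequencies by `|S|`
instead of `|Λ|`. -/
theorem sum_norm_charge_le (hN : IsChargeFamily 𝒢 R γ N) (α : Fin q) (S : Finset Λ) :
    ∑ S' : Finset Λ with S'.Nonempty ∧ S' ⊆ S, ‖N α S'‖ ≤ (S.card : ℝ) * γ := by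
  calc ∑ S' : Finset Λ with S'.Nonempty ∧ S' ⊆ S, ‖N α S'‖
      ≤ ∑ S' : Finset Λ, ∑ i ∈ S, if i ∈ S' then ‖N α S'‖ else 0 := by
        rw [Finset.sum_filter]
        refine Finset.sum_le_sum fun S' _ => ?_
        have hnn : ∀ i ∈ S, 0 ≤ if i ∈ S' then ‖N α S'‖ else 0 := fun i _ => by
          split_ifs <;> positivity
        split_ifs with h
        · obtain ⟨⟨i, hi⟩, hS⟩ := h
          refine le_trans ?_ (Finset.single_le_sum hnn (hS hi))
          simp [hi]
        · exact Finset.sum_nonneg hnn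
    _ = ∑ i ∈ S, ∑ S' : Finset Λ with i ∈ S', ‖N α S'‖ := by
        rw [Finset.sum_comm]
        simp only [Finset.sum_filter]
    _ ≤ (S.card : ℝ) * γ := by
        rw [← nsmul_eq_mul]
        exact Finset.sum_le_card_nsmul _ _ _ fun i _ => hN.local_bound α i

/-- All local charges are diagonal, with integer entries, in a common orthonormal basis. -/
theorem IsChargeFamily.exists_diagonalization (hN : IsChargeFamily 𝒢 R γ N) :
    ∃ U ∈ unitary (Op Λ d), ∃ z : Fin q → Finset Λ → (Λ → Fin d) → ℤ,
      (∀ α S, N α S = U * Matrix.diagonal (fun a => ((z α S a : ℤ) : ℂ)) * star U) ∧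
      ∀ α S a, |(z α S a : ℝ)| ≤ ‖N α S‖ := by
  obtain ⟨U, hU, n, hn⟩ := exists_unitary_diagonalization
    (fun k : Fin q × Finset Λ => N k.1 k.2) (fun k => hN.selfAdjoint k.1 k.2)
    fun k l => hN.commute k.1 l.1 k.2 l.2
  have hz : ∀ α S a, ∃ z : ℤ, n (α, S) a = (z : ℂ) := by
    intro α S a
    refine hN.integer_spectrum α S _ ?_
    have h1 := hn (α, S)
    simp only at h1
    have h2 : U * Matrix.diagonal (n (α, S)) * star U =
        ((⟨U, hU⟩ : unitary (Op Λ d)) : Op Λ d) * Matrix.diagonal (n (α, S)) *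
          (star (⟨U, hU⟩ : unitary (Op Λ d)) : Op Λ d) := rfl
    rw [h1, h2, Unitary.spectrum_star_right_conjugate, spectrum_diagonal]
    exact ⟨a, rfl⟩
  choose z hz using hz
  have hzn : ∀ α S, n (α, S) = fun a => ((z α S a : ℤ) : ℂ) := fun α S => funext (hz α S)
  refine ⟨U, hU, z, fun α S => by rw [← hzn]; exact hn (α, S), fun α S a => ?_⟩
  have h1 : ‖N α S‖ = ‖n (α, S)‖ := by
    have h2 := hn (α, S)
    simp only at h2
    rw [h2, norm_unitary_conj hU, Matrix.l2_opNorm_diagonal]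
  rw [h1]
  refine le_trans (le_of_eq ?_) (norm_le_pi_norm (n (α, S)) a)
  rw [hz, Complex.norm_intCast]

/-- The integer vectors with entries of absolute value at most `M`. -/
noncomputable def box (q M : ℕ) : Finset (Fin q → ℤ) :=
  Fintype.piFinset fun _ => Finset.Icc (-(M : ℤ)) M

/-- The scalar product `m · J`. -/
noncomputable def intDot (J : EuclideanSpace ℝ (Fin q)) (m : Fin q → ℤ) : ℝ := ∑ α, (m α : ℝ) * J α

theorem intDot_neg (J : EuclideanSpace ℝ (Fin q)) (m : Fin q → ℤ) :
    intDot J (-m) = -intDot J m := by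
  simp [intDot]

/-- Solution of the homological equation `[H⁰, A] = X - X̄` for an operator strongly supported in
`S`. -/
theorem exists_homological_solution (hN : IsChargeFamily 𝒢 R γ N) (J : EuclideanSpace ℝ (Fin q))
    (hJ : ∀ m, intDot J m = 0 → m = 0) (S : Finset Λ) (M : ℕ) (hM : 2 * ((S.card : ℝ) * γ) ≤ M)
    (X : Op Λ d) (hX : X ∈ strongAlgebra N S) (hXs : IsSelfAdjoint X) :
    ∃ A ∈ strongAlgebra N S, ∃ Y ∈ strongAlgebra N S, star A = -A ∧ IsSelfAdjoint Y ∧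
      (∀ α, Commute (total (N α)) Y) ∧ comm A (freeHamiltonian J N) = Y - X ∧ ‖Y‖ ≤ ‖X‖ ∧
      ‖A‖ ≤ (∑ m ∈ box q M, |(intDot J m)⁻¹|) * ‖X‖ := by
  obtain ⟨U, hU, z, hz, hzb⟩ := hN.exists_diagonalization
  have hU1 : star U * U = 1 := (Unitary.mem_iff.1 hU).1
  have hU2 : U * star U = 1 := (Unitary.mem_iff.1 hU).2
  -- The vector of joint eigenvalues of the charges inside `S`.
  set n : (Λ → Fin d) → Fin q → ℤ := fun a α =>
    ∑ S' : Finset Λ with S'.Nonempty ∧ S' ⊆ S, z α S' a with hn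
  have hinner : ∀ α, innerCharge N α S =
      U * Matrix.diagonal (fun a => ((n a α : ℤ) : ℂ)) * star U := by
    intro α
    have h1 : Matrix.diagonal (fun a => ((n a α : ℤ) : ℂ)) =
        ∑ S' : Finset Λ with S'.Nonempty ∧ S' ⊆ S,
          Matrix.diagonal (fun a => ((z α S' a : ℤ) : ℂ)) := by
      ext a b
      rw [Matrix.sum_apply]
      by_cases hab : a = b
      · subst hab; simp [hn]
      · simp [hab]
    rw [h1, Finset.mul_sum, Finset.sum_mul, innerCharge]
    exact Finset.sum_congr rfl fun S' _ => hz α S'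
  have hbox : ∀ a b, n a - n b ∈ box q M := by
    intro a b
    have hb : ∀ a α, |(n a α : ℝ)| ≤ (S.card : ℝ) * γ := by
      intro a α
      refine le_trans ?_ (sum_norm_charge_le hN α S)
      simp only [hn]
      push_cast
      exact (Finset.abs_sum_le_sum_abs _ _).trans (Finset.sum_le_sum fun S' _ => hzb α S' a)
    rw [box, Fintype.mem_piFinset]
    intro α
    rw [Finset.mem_Icc, ← abs_le]
    have : |((n a α - n b α : ℤ) : ℝ)| ≤ (M : ℝ) := by
      push_cast
      refine (abs_sub _ _).trans ?_
      linarith [hb a α, hb b α]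
    exact_mod_cast this
  -- conjugation to the common eigenbasis
  set Φ : ((Fin q → ℤ) → ℝ) → Op Λ d := fun f => U * schur f n (star U * X * U) * star U with hΦ
  have hconj : ∀ P Q : Op Λ d, (U * P * star U) * (U * Q * star U) = U * (P * Q) * star U := by
    intro P Q
    calc _ = U * P * (star U * U) * Q * star U := by noncomm_ring
      _ = _ := by rw [hU1]; noncomm_ring
  have hconj' : ∀ P Q : Op Λ d,
      comm (U * P * star U) (U * Q * star U) = U * comm P Q * star U := by
    intro P Q
    rw [comm, hconj, hconj, comm]; noncomm_ring
  have hΦstar : ∀ f, star (Φ f) = Φ fun m => f (-m) := by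
    intro f
    simp only [hΦ]
    rw [star_mul, star_mul, star_schur, star_star, star_mul, star_mul, star_star, hXs.star_eq,
      mul_assoc, mul_assoc]
  have hΦcomm : ∀ f α, comm (Φ f) (innerCharge N α S) = Φ fun m => -(m α : ℝ) * f m := by
    intro f α
    rw [hinner, hconj', comm_diagonal_schur]
  have hΦnorm : ∀ f, ‖Φ f‖ ≤ (∑ m ∈ box q M, |f m|) * ‖X‖ := by
    intro f
    have h1 : ‖star U * X * U‖ = ‖X‖ := by
      have := norm_unitary_conj (Unitary.star_mem hU) X
      rwa [star_star] at this
    rw [← h1]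
    simp only [hΦ]
    rw [norm_unitary_conj hU]
    exact norm_schur_le f n _ _ fun a b _ => hbox a b
  have hinnerc : ∀ α, ∀ B ∈ strongSet N S, Commute B (innerCharge N α S) := by
    intro α B hB
    refine Commute.sum_right _ _ _ fun S' hS' => ?_
    rcases hB with hB | ⟨β, T, _, rfl⟩
    · have hB' : SupportedIn Sᶜ B := hB
      refine hB'.commute_of_disjoint ((hN.supported α S').mono (Finset.mem_filter.1 hS').2.2)
        disjoint_compl_left
    · exact hN.commute _ _ _ _
  -- Every generator `B` of the commutant condition commutes with the inner charges, so in the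
  -- eigenbasis it preserves `n`; `commute_schur` then applies.
  have hΦmem : ∀ f, Φ f ∈ strongAlgebra N S := by
    intro f
    rw [strongAlgebra, Subalgebra.mem_centralizer_iff] at hX ⊢
    intro B hB
    set B' := star U * B * U with hB'
    have hBB : B = U * B' * star U := by
      rw [hB']
      calc B = (U * star U) * B * (U * star U) := by rw [hU2]; simp
        _ = _ := by noncomm_ring
    have h1 : ∀ a b, B' a b ≠ 0 → n a = n b := by
      intro a b hab
      funext α
      have h2 := (hinnerc α B hB).eq
      rw [hinner, hBB, hconj, hconj] at h2
      have h3 : B' * Matrix.diagonal (fun a => ((n a α : ℤ) : ℂ)) =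
          Matrix.diagonal (fun a => ((n a α : ℤ) : ℂ)) * B' := by
        have := congrArg (fun P => star U * P * U) h2
        have h4 : ∀ P : Op Λ d, star U * (U * P * star U) * U = P := fun P => by
          calc _ = (star U * U) * P * (star U * U) := by noncomm_ring
            _ = P := by rw [hU1]; simp
        rwa [h4, h4] at this
      have h5 := congrFun (congrFun h3 a) b
      rw [Matrix.mul_diagonal, Matrix.diagonal_mul, mul_comm] at h5
      exact_mod_cast (mul_right_cancel₀ hab h5).symm
    have h6 : Commute B' (star U * X * U) := by
      have := hX B hB
      change B' * _ = _ * B'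
      rw [hB']
      calc star U * B * U * (star U * X * U) = star U * B * (U * star U) * X * U := by noncomm_ring
        _ = star U * (B * X) * U := by rw [hU2]; noncomm_ring
        _ = star U * (X * B) * U := by rw [this]
        _ = star U * X * (U * star U) * B * U := by rw [hU2]; noncomm_ring
        _ = _ := by noncomm_ring
    have h7 := (commute_schur (f := f) h1 h6).eq
    rw [hBB]
    simp only [hΦ]
    rw [hconj, hconj, h7]
  have hΦone : Φ (fun _ => 1) = X := by
    have : schur (fun _ => 1) n (star U * X * U) = star U * X * U := by
      ext a b; simp [schur]
    simp only [hΦ]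
    rw [this]
    calc _ = (U * star U) * X * (U * star U) := by noncomm_ring
      _ = X := by rw [hU2]; simp
  -- The resonant value is `f 0 = 0`, since `0⁻¹ = 0`. Hence `-(m · J) f m = g m - 1` holds for
  -- every `m`, and `Φ g` is the charge-conserving part of `X`.
  set f : (Fin q → ℤ) → ℝ := fun m => (intDot J m)⁻¹ with hf
  set g : (Fin q → ℤ) → ℝ := fun m => if m = 0 then 1 else 0 with hg
  refine ⟨Φ f, hΦmem f, Φ g, hΦmem g, ?_, ?_, ?_, ?_, ?_, hΦnorm f⟩
  · rw [hΦstar]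
    have : (fun m => f (-m)) = fun m => -f m := by
      funext m; simp [hf, intDot_neg]
    rw [this]
    have h2 : schur (fun m => -f m) n (star U * X * U) = -schur f n (star U * X * U) := by
      ext a b; simp [schur]
    simp only [hΦ]
    rw [h2]; noncomm_ring
  · rw [isSelfAdjoint_iff, hΦstar]
    congr 1; funext m; simp [hg]
  · intro α
    have h1 := comm_total_charge hN (hΦmem g) α
    rw [hΦcomm] at h1
    have h2 : (fun m : Fin q → ℤ => -(m α : ℝ) * g m) = fun _ => 0 := by
      funext m
      by_cases hm : m = 0
      · simp [hm]
      · simp [hg, hm]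
    have h3 : schur (fun _ => 0) n (star U * X * U) = 0 := by
      ext a b; simp [schur]
    rw [h2] at h1
    simp only [hΦ] at h1
    rw [h3, mul_zero, zero_mul, comm, sub_eq_zero] at h1
    exact h1.symm
  · have h1 : comm (Φ f) (freeHamiltonian J N) =
        ∑ α, (J α : ℂ) • comm (Φ f) (total (N α)) := by
      simp [freeHamiltonian, comm, Finset.mul_sum, Finset.sum_mul, smul_sub]
    rw [h1, ← hΦone]
    have h2 : ∀ α, (J α : ℂ) • comm (Φ f) (total (N α)) =
        U * ((J α : ℂ) • schur (fun m => -(m α : ℝ) * f m) n (star U * X * U)) * star U := by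
      intro α
      rw [comm_total_charge hN (hΦmem f) α, hΦcomm]
      simp only [hΦ]
      simp
    rw [Finset.sum_congr rfl fun α _ => h2 α, ← Finset.sum_mul, ← Finset.mul_sum]
    have h3 : ∑ α, (J α : ℂ) • schur (fun m => -(m α : ℝ) * f m) n (star U * X * U) =
        schur g n (star U * X * U) - schur (fun _ => 1) n (star U * X * U) := by
      ext a b
      rw [Matrix.sum_apply]
      simp only [schur, Matrix.smul_apply, Matrix.of_apply, Matrix.sub_apply, smul_eq_mul]
      rw [← sub_mul]
      have h4 : ∑ α, (J α : ℂ) * (((-((n a - n b) α : ℝ) * f (n a - n b) : ℝ) : ℂ) *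
          (star U * X * U) a b) =
          ((-(intDot J (n a - n b)) * f (n a - n b) : ℝ) : ℂ) * (star U * X * U) a b := by
        rw [intDot]
        push_cast
        rw [← Finset.sum_neg_distrib, Finset.sum_mul, Finset.sum_mul]
        refine Finset.sum_congr rfl fun α _ => ?_
        ring
      rw [h4]
      congr 1
      have h5 : -(intDot J (n a - n b)) * f (n a - n b) = g (n a - n b) - 1 := by
        by_cases hm : n a - n b = 0
        · rw [hm]; simp [hg, intDot]
        · have : intDot J (n a - n b) ≠ 0 := fun h => hm (hJ _ h)
          simp only [hf, hg, hm, if_false]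
          field_simp
          norm_num
      rw [h5]; push_cast; ring
    rw [h3]
    simp only [hΦ]
    noncomm_ring
  · refine (hΦnorm g).trans ?_
    have : ∑ m ∈ box q M, |g m| ≤ 1 := by
      have h1 : ∀ m, |g m| = if m = 0 then 1 else 0 := fun m => by
        simp only [hg]; split_ifs <;> simp
      simp only [h1, Finset.sum_ite_eq']
      split_ifs <;> norm_num
    nlinarith [norm_nonneg X]

end Charges

/-! ### Sums of inverse small divisors -/

section SmallDivisors

/-- A set of `K` positive integers has sum of reciprocals at most `2 + log K`. -/
theorem sum_inv_le_two_add_log (T : Finset ℕ) (hT : ∀ j ∈ T, 1 ≤ j) :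
    ∑ j ∈ T, (j : ℝ)⁻¹ ≤ 2 + Real.log T.card := by
  rcases Nat.eq_zero_or_pos T.card with h0 | h0
  · rw [Finset.card_eq_zero] at h0; subst h0; simp
  have hK : (0 : ℝ) < T.card := by exact_mod_cast h0
  -- Elements up to `K` contribute at most a harmonic sum; the others are at most `K` in number,
  -- each contributing at most `1/K`.
  rw [← Finset.sum_filter_add_sum_filter_not T (fun j => j ≤ T.card)]
  have h1 : ∑ j ∈ T with j ≤ T.card, (j : ℝ)⁻¹ ≤ 1 + Real.log T.card := by
    refine le_trans ?_ (harmonic_le_one_add_log T.card)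
    rw [harmonic_eq_sum_Icc]
    push_cast
    refine Finset.sum_le_sum_of_subset_of_nonneg (fun j hj => ?_) fun _ _ _ => by positivity
    rw [Finset.mem_filter] at hj
    exact Finset.mem_Icc.2 ⟨hT j hj.1, hj.2⟩
  have h2 : ∑ j ∈ T with ¬ j ≤ T.card, (j : ℝ)⁻¹ ≤ 1 := by
    calc _ ≤ (T.filter fun j => ¬ j ≤ T.card).card • (T.card : ℝ)⁻¹ := by
          refine Finset.sum_le_card_nsmul _ _ _ fun j hj => ?_
          rw [Finset.mem_filter, not_le] at hj
          have : (T.card : ℝ) ≤ j := by exact_mod_cast hj.2.le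
          gcongr
      _ ≤ T.card • (T.card : ℝ)⁻¹ := by
          gcongr
          exact Finset.filter_subset _ _
      _ = 1 := by rw [nsmul_eq_mul]; field_simp
  linarith

/-- Separation makes the floors of `y m / Δ` distinct positive integers, which reduces the sum to
reciprocals of integers. -/
theorem sum_inv_le_of_separated_of_pos {β : Type*} (F : Finset β) (y : β → ℝ)
    {Δ : ℝ} (hΔ : 0 < Δ) (hy : ∀ m ∈ F, Δ ≤ y m)
    (hsep : ∀ m ∈ F, ∀ m' ∈ F, m ≠ m' → Δ ≤ |y m - y m'|) :
    ∑ m ∈ F, (y m)⁻¹ ≤ (2 + Real.log F.card) / Δ := by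
  classical
  have hfl : ∀ m ∈ F, (⌊y m / Δ⌋₊ : ℝ) * Δ ≤ y m := fun m hm => by
    rw [← le_div_iff₀ hΔ]
    exact Nat.floor_le (div_nonneg (hΔ.le.trans (hy m hm)) hΔ.le)
  have hfl' : ∀ m, y m < (⌊y m / Δ⌋₊ + 1 : ℝ) * Δ := fun m => by
    rw [← div_lt_iff₀ hΔ]
    exact Nat.lt_floor_add_one _
  have hone : ∀ m ∈ F, 1 ≤ ⌊y m / Δ⌋₊ := fun m hm => by
    rw [Nat.one_le_floor_iff, le_div_iff₀ hΔ, one_mul]; exact hy m hm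
  have hinj : Set.InjOn (fun m => ⌊y m / Δ⌋₊) F := by
    intro m hm m' hm' h
    by_contra hne
    have h1 := hsep m hm m' hm' hne
    have h2 := hfl m hm
    have h3 := hfl' m
    have h4 := hfl m' hm'
    have h5 := hfl' m'
    simp only at h
    rw [h] at h2 h3
    have : |y m - y m'| < Δ := by
      rw [abs_lt]; constructor <;> linarith
    linarith
  have h1 := sum_inv_le_two_add_log (F.image fun m => ⌊y m / Δ⌋₊) (by
    intro j hj
    obtain ⟨m, hm, rfl⟩ := Finset.mem_image.1 hj
    exact hone m hm)
  rw [Finset.sum_image hinj, Finset.card_image_of_injOn hinj] at h1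
  rw [le_div_iff₀ hΔ]
  refine le_trans ?_ h1
  rw [Finset.sum_mul]
  refine Finset.sum_le_sum fun m hm => ?_
  have hj : (0 : ℝ) < ⌊y m / Δ⌋₊ := by exact_mod_cast hone m hm
  have hym : 0 < y m := hΔ.trans_le (hy m hm)
  rw [inv_mul_le_iff₀ hym, ← div_eq_mul_inv, le_div_iff₀ hj, mul_comm]
  exact hfl m hm

theorem sum_abs_inv_le_of_separated {β : Type*} (F : Finset β) (y : β → ℝ) {Δ : ℝ} (hΔ : 0 < Δ)
    (hy : ∀ m ∈ F, Δ ≤ |y m|) (hsep : ∀ m ∈ F, ∀ m' ∈ F, m ≠ m' → Δ ≤ |y m - y m'|) :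
    ∑ m ∈ F, |(y m)⁻¹| ≤ 2 * (2 + Real.log F.card) / Δ := by
  have hlog : ∀ P : β → Prop, [DecidablePred P] → Real.log (F.filter P).card ≤ Real.log F.card := by
    intro P _
    rcases Nat.eq_zero_or_pos (F.filter P).card with h | h
    · rw [h]; simp [Real.log_natCast_nonneg]
    · exact Real.log_le_log (by exact_mod_cast h) (by exact_mod_cast Finset.card_filter_le _ _)
  rw [← Finset.sum_filter_add_sum_filter_not F (fun m => 0 < y m)]
  have h1 : ∑ m ∈ F with 0 < y m, |(y m)⁻¹| ≤ (2 + Real.log F.card) / Δ := by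
    calc _ = ∑ m ∈ F with 0 < y m, (y m)⁻¹ := by
          refine Finset.sum_congr rfl fun m hm => abs_of_pos (inv_pos.2 (Finset.mem_filter.1 hm).2)
      _ ≤ (2 + Real.log (F.filter fun m => 0 < y m).card) / Δ := by
          refine sum_inv_le_of_separated_of_pos _ _ hΔ (fun m hm => ?_) fun m hm m' hm' hne => ?_
          · rw [Finset.mem_filter] at hm
            rw [← abs_of_pos hm.2]; exact hy m hm.1
          · exact hsep m (Finset.mem_filter.1 hm).1 m' (Finset.mem_filter.1 hm').1 hne
      _ ≤ _ := by gcongr ?_ / _; linarith [hlog fun m => 0 < y m]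
  have h2 : ∑ m ∈ F with ¬ 0 < y m, |(y m)⁻¹| ≤ (2 + Real.log F.card) / Δ := by
    calc _ = ∑ m ∈ F with ¬ 0 < y m, (-y m)⁻¹ := by
          refine Finset.sum_congr rfl fun m hm => ?_
          have := (Finset.mem_filter.1 hm).2
          rw [abs_inv, abs_of_nonpos (not_lt.1 this)]
      _ ≤ (2 + Real.log (F.filter fun m => ¬ 0 < y m).card) / Δ := by
          refine sum_inv_le_of_separated_of_pos _ (fun m => -y m) hΔ (fun m hm => ?_)
            fun m hm m' hm' hne => ?_
          · rw [Finset.mem_filter] at hm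
            rw [← abs_of_nonpos (not_lt.1 hm.2)]; exact hy m hm.1
          · rw [neg_sub_neg, abs_sub_comm]
            exact hsep m (Finset.mem_filter.1 hm).1 m' (Finset.mem_filter.1 hm').1 hne
      _ ≤ _ := by gcongr ?_ / _; linarith [hlog fun m => ¬ 0 < y m]
  calc _ ≤ _ := add_le_add h1 h2
    _ = _ := by ring

variable {q : ℕ}

theorem norm_toLp_int_le {m : Fin q → ℤ} {B : ℝ} (hB : 0 ≤ B) (hm : ∀ α, |(m α : ℝ)| ≤ B) :
    ‖WithLp.toLp 2 (fun α => (m α : ℝ))‖ ≤ q * B := by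
  refine abs_le_of_sq_le_sq' ?_ (by positivity) |>.2
  rw [EuclideanSpace.norm_sq_eq]
  calc ∑ α, ‖(m α : ℝ)‖ ^ 2 ≤ ∑ _α : Fin q, B ^ 2 := by
        refine Finset.sum_le_sum fun α _ => ?_
        gcongr
        exact hm α
    _ = q * B ^ 2 := by simp
    _ ≤ (q * B) ^ 2 := by
        rw [mul_pow]
        gcongr
        have : (q : ℝ) ≤ ((q ^ 2 : ℕ) : ℝ) := by exact_mod_cast Nat.le_self_pow (by norm_num) q
        exact_mod_cast this

theorem intDot_sub (J : EuclideanSpace ℝ (Fin q)) (m m' : Fin q → ℤ) :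
    intDot J (m - m') = intDot J m - intDot J m' := by
  simp [intDot, sub_mul, Finset.sum_sub_distrib]

/-- The exponent of a Diophantine condition can be lowered to zero when there is one frequency. -/
theorem Diophantine.exists_exponent {J : EuclideanSpace ℝ (Fin q)} {x τ p : ℝ} (hJ : J ≠ 0)
    (hτ : 0 < τ) (h : Diophantine J x τ) (hp : (q : ℝ) + τ < p) :
    1 < p ∧ ∃ τ' : ℝ, 0 ≤ τ' ∧ τ' + min 1 (p - 1) ≤ p - 1 ∧ Diophantine J x τ' := by
  rcases Nat.lt_or_ge q 2 with hq | hq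
  · obtain rfl | rfl : q = 0 ∨ q = 1 := by omega
    · exact absurd (Subsingleton.elim J 0) hJ
    · push_cast at hp
      refine ⟨by linarith, 0, le_rfl, by simp, fun m hm => ?_⟩
      have h1 := h (fun _ => 1) (by intro h; simpa using congrFun h 0)
      have h2 : ‖(WithLp.toLp 2 (fun _ => ((1 : ℤ) : ℝ)) : EuclideanSpace ℝ (Fin 1))‖ = 1 := by
        simp [EuclideanSpace.norm_eq]
      rw [h2] at h1
      simp only [Real.one_rpow, div_one, Finset.univ_unique, Finset.sum_singleton, Int.cast_one,
        one_mul, Real.rpow_zero] at h1 ⊢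
      have hm0 : m default ≠ 0 := fun h0 => hm (funext fun i => by
        rw [Subsingleton.elim i default, h0]; rfl)
      have h3 : (1 : ℝ) ≤ |(m default : ℝ)| := by exact_mod_cast Int.one_le_abs hm0
      rw [abs_mul]
      nlinarith [abs_nonneg (J default)]
  · have hq' : (2 : ℝ) ≤ q := by exact_mod_cast hq
    -- For `q ≥ 2`, the condition on `p` gives `p - 1 > q - 1 + τ ≥ 1 + τ`, so a full power is left
    -- over for the logarithm.
    refine ⟨by linarith, τ, hτ.le, ?_, h⟩
    linarith [min_le_left (1 : ℝ) (p - 1)]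

/-- The difference of two box vectors lies in the doubled box, so one Diophantine bound gives both
the size and the separation of the divisors. The sum is then logarithmic in the number of vectors,
and `s ^ η` absorbs the logarithm. -/
theorem exists_divisor_bound (γ p : ℝ) (q : ℕ) :
    ∃ Γ : ℝ, 0 < Γ ∧ ∀ (J : EuclideanSpace ℝ (Fin q)) (x τ : ℝ), J ≠ 0 → 0 < x → 0 < τ →
      Diophantine J x τ → (q : ℝ) + τ < p → ∀ s : ℕ, 1 ≤ s →
      ∃ M : ℕ, 2 * ((s : ℝ) * γ) ≤ M ∧
        ∑ m ∈ box q M, |(intDot J m)⁻¹| ≤ Γ / (x * ‖J‖) * (s : ℝ) ^ (p - 1) := by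
  by_cases hpq : 1 < p ∧ 1 ≤ q
  swap
  · refine ⟨1, one_pos, fun J x τ hJ hx hτ hD hp => ?_⟩
    exfalso
    apply hpq
    refine ⟨(hD.exists_exponent hJ hτ hp).1, ?_⟩
    by_contra h0
    obtain rfl : q = 0 := by omega
    exact hJ (Subsingleton.elim J 0)
  obtain ⟨hp1, hq1⟩ := hpq
  have hqR : (1 : ℝ) ≤ q := by exact_mod_cast hq1
  set η := min 1 (p - 1) with hη
  have hη0 : 0 < η := lt_min one_pos (by linarith)
  set L : ℕ := max 1 ⌈2 * γ⌉₊ with hL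
  have hL1 : (1 : ℝ) ≤ L := by exact_mod_cast le_max_left _ _
  have hLγ : 2 * γ ≤ L := (Nat.le_ceil _).trans (by exact_mod_cast le_max_right _ _)
  -- The exponent `p` replaces the smaller `τ'`, so that the constant does not depend on `τ`.
  set Γ : ℝ := 2 * (q * (2 * L)) ^ p * (2 + q * ((3 * L) ^ η / η)) with hΓ
  refine ⟨Γ, by positivity, fun J x τ hJ hx hτ hD hp s hs => ⟨s * L, ?_, ?_⟩⟩
  · push_cast
    have : (0 : ℝ) ≤ s := Nat.cast_nonneg s
    nlinarith
  obtain ⟨-, τ', hτ0, hτp, hD'⟩ := hD.exists_exponent hJ hτ hp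
  have hs1 : (1 : ℝ) ≤ s := by exact_mod_cast hs
  have hJ0 : 0 < ‖J‖ := norm_pos_iff.2 hJ
  set B : ℝ := q * (2 * (s * L)) with hB
  have hB0 : 0 < B := by positivity
  set Δ := x * ‖J‖ / B ^ τ' with hΔ
  have hΔ0 : 0 < Δ := by positivity
  have hdiv : ∀ m : Fin q → ℤ, m ≠ 0 → (∀ α, |(m α : ℝ)| ≤ 2 * (s * L)) → Δ ≤ |intDot J m| := by
    intro m hm hmb
    refine le_trans ?_ (hD' m hm)
    have h1 : 0 < ‖WithLp.toLp 2 (fun α => (m α : ℝ))‖ := by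
      rw [norm_pos_iff]
      intro h0
      apply hm
      funext α
      have := congrArg (fun v : EuclideanSpace ℝ (Fin q) => v α) h0
      simpa using this
    rw [hΔ]
    gcongr
    exact norm_toLp_int_le (by positivity) hmb
  have hbox : ∀ m ∈ box q (s * L), ∀ α, |(m α : ℝ)| ≤ s * L := by
    intro m hm α
    have := Fintype.mem_piFinset.1 hm α
    rw [Finset.mem_Icc, ← abs_le] at this
    exact_mod_cast this
  have hsl : (1 : ℝ) ≤ s * L := by nlinarith
  have hsum : ∑ m ∈ box q (s * L), |(intDot J m)⁻¹| =
      ∑ m ∈ (box q (s * L)).filter (· ≠ 0), |(intDot J m)⁻¹| := by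
    rw [Finset.sum_filter]
    refine Finset.sum_congr rfl fun m _ => ?_
    by_cases hm : m = 0
    · simp [hm, intDot]
    · simp [hm]
  have hcard : Real.log ((box q (s * L)).filter (· ≠ 0)).card ≤ q * ((3 * (s * L)) ^ η / η) := by
    have h1 : (((box q (s * L)).filter (· ≠ 0)).card : ℝ) ≤ (3 * (s * L) : ℝ) ^ q := by
      calc (((box q (s * L)).filter (· ≠ 0)).card : ℝ) ≤ ((box q (s * L)).card : ℝ) := by
            exact_mod_cast Finset.card_filter_le _ _
        _ = (((2 * (s * L) + 1) ^ q : ℕ) : ℝ) := by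
            congr 1
            rw [box, Fintype.card_piFinset_const, Int.card_Icc]
            generalize s * L = M
            congr 1
            omega
        _ ≤ _ := by
            push_cast
            gcongr
            linarith
    have h2 : (0 : ℝ) < 3 * (s * L) := by positivity
    rcases Nat.eq_zero_or_pos ((box q (s * L)).filter (· ≠ 0)).card with h0 | h0
    · rw [h0]; simp; positivity
    · calc _ ≤ Real.log ((3 * (s * L) : ℝ) ^ q) := Real.log_le_log (by exact_mod_cast h0) h1
        _ = q * Real.log (3 * (s * L)) := Real.log_pow _ _
        _ ≤ _ := by
            gcongr
            exact Real.log_le_rpow_div h2.le hη0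
  rw [hsum]
  refine (sum_abs_inv_le_of_separated _ _ hΔ0 (fun m hm => ?_) fun m hm m' hm' hne => ?_).trans ?_
  · rw [Finset.mem_filter] at hm
    exact hdiv m hm.2 fun α => by linarith [hbox m hm.1 α]
  · rw [Finset.mem_filter] at hm hm'
    rw [← intDot_sub]
    refine hdiv _ (sub_ne_zero.2 hne) fun α => ?_
    simp only [Pi.sub_apply]
    push_cast
    exact (abs_sub _ _).trans (by linarith [hbox m hm.1 α, hbox m' hm'.1 α])
  · have hη1 : (1 : ℝ) ≤ (s : ℝ) ^ η := Real.one_le_rpow hs1 hη0.le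
    have e1 : (3 * (s * L) : ℝ) ^ η = (3 * L) ^ η * (s : ℝ) ^ η := by
      rw [← Real.mul_rpow (by positivity) (by positivity)]; congr 1; ring
    have e2 : B ^ τ' = (q * (2 * L)) ^ τ' * (s : ℝ) ^ τ' := by
      rw [← Real.mul_rpow (by positivity) (by positivity)]; congr 1; rw [hB]; ring
    have e3 : ((q : ℝ) * (2 * L)) ^ τ' ≤ (q * (2 * L)) ^ p :=
      Real.rpow_le_rpow_of_exponent_le (by nlinarith) (by linarith)
    have e4 : (s : ℝ) ^ τ' * (s : ℝ) ^ η ≤ (s : ℝ) ^ (p - 1) := by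
      rw [← Real.rpow_add (by positivity)]
      exact Real.rpow_le_rpow_of_exponent_le hs1 hτp
    calc 2 * (2 + Real.log ((box q (s * L)).filter (· ≠ 0)).card) / Δ
        ≤ 2 * (2 * (s : ℝ) ^ η + q * ((3 * (s * L)) ^ η / η)) / Δ := by
          gcongr
          linarith
      _ = 2 * (2 + q * ((3 * L) ^ η / η)) * (q * (2 * L)) ^ τ' / (x * ‖J‖) *
            ((s : ℝ) ^ τ' * (s : ℝ) ^ η) := by
          rw [hΔ, e2, e1]; field_simp
      _ ≤ 2 * (2 + q * ((3 * L) ^ η / η)) * (q * (2 * L)) ^ p / (x * ‖J‖) *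
            (s : ℝ) ^ (p - 1) := by gcongr
      _ = _ := by rw [hΓ]; ring

end SmallDivisors

/-! ### One step of the normal form -/

section Step

variable {Λ : Type*} [Fintype Λ] [DecidableEq Λ] {d q : ℕ}
  {𝒢 : SimpleGraph Λ} {R : ℕ} {γ : ℝ} {N : Fin q → Finset Λ → Op Λ d}

theorem star_total_of_star_eq_neg {A : Finset Λ → Op Λ d} (hA : ∀ S, star (A S) = -A S) :
    star (total A) = -total A := by
  rw [total, star_sum, ← Finset.sum_neg_distrib]
  exact Finset.sum_congr rfl fun S _ => hA S

/-- Solution of the homological equation for a potential. -/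
theorem exists_potential_solution (hN : IsChargeFamily 𝒢 R γ N) (J : EuclideanSpace ℝ (Fin q))
    (hJ : ∀ m, intDot J m = 0 → m = 0) {Q p : ℝ}
    (hQ : ∀ s : ℕ, 1 ≤ s → ∃ M : ℕ, 2 * ((s : ℝ) * γ) ≤ M ∧
      ∑ m ∈ box q M, |(intDot J m)⁻¹| ≤ Q * (s : ℝ) ^ (p - 1))
    {V : Finset Λ → Op Λ d} (hV : IsPotential 𝒢 N V) (hVs : ∀ S, IsSelfAdjoint (V S)) :
    ∃ A Y : Finset Λ → Op Λ d, IsPotential 𝒢 N A ∧ IsPotential 𝒢 N Y ∧ (∀ S, star (A S) = -A S) ∧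
      (∀ S, IsSelfAdjoint (Y S)) ∧ (∀ α, Commute (total (N α)) (total Y)) ∧
      comm (total A) (freeHamiltonian J N) = total (Y - V) ∧ (∀ S, ‖Y S‖ ≤ ‖V S‖) ∧
      ∀ S, ‖A S‖ ≤ Q * (S.card : ℝ) ^ (p - 1) * ‖V S‖ := by
  have key : ∀ S : Finset Λ, ∃ A Y : Op Λ d, (A ∈ strongAlgebra N S ∧ Y ∈ strongAlgebra N S) ∧
      (star A = -A ∧ IsSelfAdjoint Y) ∧ (∀ α, Commute (total (N α)) Y) ∧
      comm A (freeHamiltonian J N) = Y - V S ∧ ‖Y‖ ≤ ‖V S‖ ∧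
      ‖A‖ ≤ Q * (S.card : ℝ) ^ (p - 1) * ‖V S‖ := by
    intro S
    by_cases hS : IsConnectedSet 𝒢 S
    · have hcard : 1 ≤ S.card := by
        rw [Nat.one_le_iff_ne_zero, Finset.card_ne_zero, Finset.nonempty_iff_ne_empty]
        rintro rfl
        exact not_isConnectedSet_empty hS
      obtain ⟨M, hM, hMb⟩ := hQ S.card hcard
      obtain ⟨A, hA, Y, hY, h1, h2, h3, h4, h5, h6⟩ :=
        exists_homological_solution hN J hJ S M hM (V S) (hV.mem S) (hVs S)
      exact ⟨A, Y, ⟨hA, hY⟩, ⟨h1, h2⟩, h3, h4, h5, h6.trans (by gcongr)⟩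
    · refine ⟨0, 0, ⟨zero_mem _, zero_mem _⟩, ⟨by simp, IsSelfAdjoint.zero _⟩,
        fun α => Commute.zero_right _, ?_, ?_, ?_⟩ <;> simp [hV.eq_zero S hS, comm]
  choose A Y hmem hst hcm hsol hYb hAb using key
  have hz : ∀ S, ¬ IsConnectedSet 𝒢 S → V S = 0 := hV.eq_zero
  refine ⟨A, Y, isPotential_of_mem (fun S => (hmem S).1) fun S hS => ?_,
    isPotential_of_mem (fun S => (hmem S).2) fun S hS => ?_, fun S => (hst S).1,
    fun S => (hst S).2, fun α => ?_, ?_, hYb, hAb⟩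
  · have := hAb S
    rw [hz S hS, norm_zero, mul_zero] at this
    exact norm_le_zero_iff.1 this
  · have := hYb S
    rw [hz S hS, norm_zero] at this
    exact norm_le_zero_iff.1 this
  · exact Commute.sum_right _ _ _ fun S _ => hcm S α
  · rw [total, comm_sum_left, total]
    exact Finset.sum_congr rfl fun S _ => hsol S

theorem rpow_le_factorial_mul_exp {a : ℝ} (ha : 0 ≤ a) {y : ℝ} (hy : 0 < y) :
    y ^ a ≤ (⌈a⌉₊.factorial : ℝ) * Real.exp y := by
  rcases le_total 1 y with h | h
  · have h1 := Real.pow_div_factorial_le_exp y (by linarith) ⌈a⌉₊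
    rw [div_le_iff₀ (by positivity)] at h1
    calc y ^ a ≤ y ^ (⌈a⌉₊ : ℝ) := Real.rpow_le_rpow_of_exponent_le h (Nat.le_ceil a)
      _ = y ^ ⌈a⌉₊ := Real.rpow_natCast _ _
      _ ≤ _ := by linarith
  · have h1 : (1 : ℝ) ≤ ⌈a⌉₊.factorial := by
      exact_mod_cast Nat.one_le_iff_ne_zero.2 (Nat.factorial_ne_zero ⌈a⌉₊)
    have h2 : 1 ≤ Real.exp y := Real.one_le_exp hy.le
    have h3 : y ^ a ≤ 1 := Real.rpow_le_one hy.le h ha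
    nlinarith

/-- The polynomial weight is paid for by a loss of rate: `|S|^a ≤ C δ^(-a) e^(δ|S|)`. -/
theorem LocBound.weight {κ δ v Q a C : ℝ} {A V : Finset Λ → Op Λ d} (hV : LocBound κ V v)
    (hδ : 0 < δ) (hQ : 0 ≤ Q) (hC : ∀ y : ℝ, 0 < y → y ^ a ≤ C * Real.exp y)
    (hA : ∀ S, ‖A S‖ ≤ Q * (S.card : ℝ) ^ a * ‖V S‖) :
    LocBound (κ - δ) A (Q * C * δ ^ (-a) * v) := by
  intro i
  have hC0 : 0 ≤ C := by
    have := hC 1 one_pos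
    rw [Real.one_rpow] at this
    by_contra h
    nlinarith [Real.exp_pos 1]
  calc ∑ S : Finset Λ with i ∈ S, Real.exp ((κ - δ) * (S.card : ℝ)) * ‖A S‖
      ≤ ∑ S : Finset Λ with i ∈ S, Q * C * δ ^ (-a) * (Real.exp (κ * (S.card : ℝ)) * ‖V S‖) := by
        refine Finset.sum_le_sum fun S hS => ?_
        have hs : (0 : ℝ) < S.card := by
          exact_mod_cast Finset.card_pos.2 ⟨i, (Finset.mem_filter.1 hS).2⟩
        have h1 : (S.card : ℝ) ^ a ≤ C * δ ^ (-a) * Real.exp (δ * S.card) := by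
          have h2 := hC (δ * S.card) (by positivity)
          rw [Real.mul_rpow hδ.le hs.le] at h2
          have h3 : δ ^ (-a) * δ ^ a = 1 := by
            rw [← Real.rpow_add hδ]; simp
          calc (S.card : ℝ) ^ a = δ ^ (-a) * (δ ^ a * (S.card : ℝ) ^ a) := by
                rw [← mul_assoc, h3, one_mul]
            _ ≤ δ ^ (-a) * (C * Real.exp (δ * S.card)) := by gcongr
            _ = _ := by ring
        have h4 : Real.exp (κ * (S.card : ℝ)) =
            Real.exp ((κ - δ) * S.card) * Real.exp (δ * S.card) := by
          rw [← Real.exp_add]; ring_nf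
        calc _ ≤ Real.exp ((κ - δ) * (S.card : ℝ)) *
              (Q * (C * δ ^ (-a) * Real.exp (δ * S.card)) * ‖V S‖) := by
              gcongr
              exact (hA S).trans (by gcongr)
          _ = _ := by rw [h4]; ring
    _ ≤ _ := by
        rw [← Finset.mul_sum]
        gcongr
        exact hV i

/-- Only terms meeting `S` contribute, and each is charged to a site of `S`. -/
theorem norm_comm_total_le {A : Finset Λ → Op Λ d} {κ a : ℝ} (hA : IsPotential 𝒢 N A)
    (hAb : LocBound κ A a) (hκ : 0 ≤ κ) {S : Finset Λ} {O : Op Λ d} (hO : SupportedIn S O) :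
    ‖comm (total A) O‖ ≤ 2 * a * S.card * ‖O‖ := by
  have hA0 := hAb.mono hκ le_rfl
  rw [total, comm_sum_left]
  calc ‖∑ T, comm (A T) O‖ ≤ ∑ T : Finset Λ, ∑ j ∈ S, if j ∈ T then 2 * ‖A T‖ * ‖O‖ else 0 := by
        refine (norm_sum_le _ _).trans (Finset.sum_le_sum fun T _ => ?_)
        have hnn : ∀ j ∈ S, 0 ≤ if j ∈ T then 2 * ‖A T‖ * ‖O‖ else 0 := fun j _ => by
          split_ifs <;> positivity
        by_cases h : Disjoint T S
        · rw [comm_eq_zero ((hA.supportedIn T).commute_of_disjoint hO h), norm_zero]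
          exact Finset.sum_nonneg hnn
        · obtain ⟨j, hjT, hjS⟩ := Finset.not_disjoint_iff.1 h
          refine le_trans ?_ (Finset.single_le_sum hnn hjS)
          rw [if_pos hjT]
          exact norm_comm_le _ _
    _ = ∑ j ∈ S, 2 * ‖O‖ * ∑ T : Finset Λ with j ∈ T, ‖A T‖ := by
        rw [Finset.sum_comm]
        refine Finset.sum_congr rfl fun j _ => ?_
        rw [Finset.sum_filter, Finset.mul_sum]
        refine Finset.sum_congr rfl fun T _ => ?_
        split_ifs <;> ring
    _ ≤ ∑ j ∈ S, 2 * ‖O‖ * a := by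
        refine Finset.sum_le_sum fun j _ => ?_
        gcongr
        simpa using hA0 j
    _ = _ := by rw [Finset.sum_const, nsmul_eq_mul]; ring

/-- A rotated frame for `H`, with potentials of rate `κ`: `dB` and `v` bound the charge-conserving
part and the remainder, and `b` the distance of the conjugation from the identity. -/
structure IsFrame (𝒢 : SimpleGraph Λ) (N : Fin q → Finset Λ → Op Λ d)
    (J : EuclideanSpace ℝ (Fin q)) (H : Op Λ d) (κ₁ κ dB v b : ℝ)
    (Y : Op Λ d) (D V : Finset Λ → Op Λ d) : Prop where
  mem_unitary : Y ∈ unitary (Op Λ d)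
  potD : IsPotential 𝒢 N D
  selfAdjointD : ∀ S, IsSelfAdjoint (D S)
  potV : IsPotential 𝒢 N V
  selfAdjointV : ∀ S, IsSelfAdjoint (V S)
  conj_eq : Y * H * star Y = freeHamiltonian J N + total D + total V
  commute : ∀ α, Commute (total (N α)) (total D)
  boundD : LocBound κ D dB
  boundV : LocBound κ V v
  conj_potential : ∀ (G : Finset Λ → Op Λ d) (B : ℝ), IsPotential 𝒢 N G → 0 ≤ B → LocBound κ₁ G B →
    ∃ K : Finset Λ → Op Λ d, IsPotential 𝒢 N K ∧
      total K = Y * total G * star Y - total G ∧ LocBound κ K (b * B)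
  conj_local : ∀ (S : Finset Λ) (O : Op Λ d), SupportedIn S O →
    ‖Y * O * star Y - O‖ ≤ b * (S.card : ℝ) * ‖O‖

/-- One step of the iteration: the remainder becomes quadratically small, up to the loss of rate. -/
theorem IsFrame.step (hN : IsChargeFamily 𝒢 R γ N) {J : EuclideanSpace ℝ (Fin q)}
    (hJ : ∀ m, intDot J m = 0 → m = 0) {Q p C : ℝ} (hQ0 : 0 ≤ Q)
    (hQ : ∀ s : ℕ, 1 ≤ s → ∃ M : ℕ, 2 * ((s : ℝ) * γ) ≤ M ∧
      ∑ m ∈ box q M, |(intDot J m)⁻¹| ≤ Q * (s : ℝ) ^ (p - 1))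
    (hC : ∀ y : ℝ, 0 < y → y ^ (p - 1) ≤ C * Real.exp y) (hC0 : 0 ≤ C)
    {H Y : Op Λ d} {D V : Finset Λ → Op Λ d} {κ₁ κ dB v b δ r : ℝ}
    (hF : IsFrame 𝒢 N J H κ₁ κ dB v b Y D V) (hκ₁ : κ ≤ κ₁) (hδ : 0 < δ) (hδ6 : δ ≤ 6)
    (hδκ : 2 * δ ≤ κ) (hdB : 0 ≤ dB) (hv : 0 ≤ v) (hb : 0 ≤ b)
    (hr : r = 12 * (Q * C * δ ^ (-p) * v)) (hr1 : r ≤ 1) :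
    ∃ (Y' : Op Λ d) (D' V' : Finset Λ → Op Λ d),
      IsFrame 𝒢 N J H κ₁ (κ - 2 * δ) (dB + v) (r * (dB + 3 * v)) (b + r * (1 + b)) Y' D' V' := by
  obtain ⟨A, X, hA, hX, hAs, hXs, hXc, hsol, hXb, hAn⟩ :=
    exists_potential_solution hN J hJ hQ hF.potV hF.selfAdjointV
  set a := Q * C * δ ^ (-(p - 1)) * v with ha
  have ha0 : 0 ≤ a := by positivity
  -- The small divisors cost `δ^(-(p-1))` and the conjugation one more `1/δ`, which gives the
  -- exponent `p`.
  have hra : r = 12 * a / δ := by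
    have : δ ^ (-(p - 1)) = δ ^ (-p) * δ := by
      rw [← Real.rpow_add_one hδ.ne']; congr 1; ring
    rw [hr, ha, this]; field_simp
  have hr0 : 0 ≤ r := by rw [hra]; positivity
  have hsmall : 12 * a ≤ δ := by
    rw [hra, div_le_one hδ] at hr1; exact hr1
  have hAb : LocBound (κ - δ) A a := hF.boundV.weight hδ hQ0 hC hAn
  have hδκ' : δ ≤ κ - δ := by linarith
  have hκδ : κ - δ ≤ κ := by linarith
  have e1 : κ - δ - δ = κ - 2 * δ := by ring
  have hXb' : LocBound κ X v := hF.boundV.of_norm_le hXb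
  -- Conjugating `H⁰` produces `X - V` at first order, which cancels `V`. The corrections from `H⁰`,
  -- `D` and `V` are bounded by `r` times `2v`, `dB` and `v`, hence `r * (dB + 3 * v)`.
  obtain ⟨K₀, hK₀, hK₀b, hK₀e, hK₀s⟩ := exists_potential_conj_of_comm hA (hX.sub hF.potV) hsol hAb
    ((hXb'.sub hF.boundV).mono hκδ le_rfl) hδ hδκ' ha0 (by positivity) hsmall
  obtain ⟨K₁, hK₁, hK₁b, hK₁e, hK₁s⟩ := exists_potential_conj hA hF.potD hAb
    (hF.boundD.mono hκδ le_rfl) hδ hδκ' ha0 hdB hsmall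
  obtain ⟨K₂, hK₂, hK₂b, hK₂e, hK₂s⟩ := exists_potential_conj hA hF.potV hAb
    (hF.boundV.mono hκδ le_rfl) hδ hδκ' ha0 hv hsmall
  have hAst := star_total_of_star_eq_neg hAs
  set u := NormedSpace.exp (total A) with hu
  have huu : u ∈ unitary (Op Λ d) := exp_mem_unitary_of_star_eq_neg hAst
  have hus : star u = NormedSpace.exp (-total A) := star_exp_of_star_eq_neg hAst
  rw [← hus] at hK₀e hK₁e hK₂e
  rw [e1, ← hra] at hK₀b hK₁b hK₂b
  have hsub : ∀ P : Op Λ d, u * Y * P * star (u * Y) = u * (Y * P * star Y) * star u := by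
    intro P; rw [star_mul]; noncomm_ring
  refine ⟨u * Y, D + X, K₀ + K₁ + K₂, ⟨mul_mem huu hF.mem_unitary, hF.potD.add hX,
    fun S => (hF.selfAdjointD S).add (hXs S), (hK₀.add hK₁).add hK₂, fun S => ?_, ?_, fun α => ?_,
    ?_, ?_, ?_, ?_⟩⟩
  · exact ((hK₀s hAs (fun S => (hXs S).sub (hF.selfAdjointV S)) S).add
      (hK₁s hAs hF.selfAdjointD S)).add (hK₂s hAs hF.selfAdjointV S)
  · rw [hsub, hF.conj_eq, mul_add, mul_add, add_mul, add_mul, hK₀e]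
    rw [eq_sub_iff_add_eq] at hK₁e hK₂e
    rw [← hK₁e, ← hK₂e]
    simp only [total_add, total_sub]
    abel
  · rw [total_add]; exact (hF.commute α).add_right (hXc α)
  · exact (hF.boundD.add hXb').mono (by linarith) le_rfl
  · exact ((hK₀b.add hK₁b).add hK₂b).mono le_rfl (le_of_eq (by ring))
  · intro G B hG hB hGB
    obtain ⟨K, hK, hKe, hKb⟩ := hF.conj_potential G B hG hB hGB
    obtain ⟨K', hK', hK'b, hK'e, -⟩ := exists_potential_conj hA (hG.add hK) hAb
      (((hGB.mono hκ₁ le_rfl).add hKb).mono hκδ le_rfl) hδ hδκ' ha0 (by positivity) hsmall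
    rw [← hus, ← hu] at hK'e
    rw [e1, ← hra] at hK'b
    refine ⟨K + K', hK.add hK', ?_, ?_⟩
    · have : total (G + K) = Y * total G * star Y := by rw [total_add, hKe]; abel
      rw [this] at hK'e
      rw [total_add, hK'e, hKe, hsub]; abel
    · exact ((hKb.mono (by linarith) le_rfl).add hK'b).mono le_rfl (le_of_eq (by ring))
  · intro S O hO
    have h1 := hF.conj_local S O hO
    have h2 := norm_exp_conj_sub_le hAst O
    rw [← hus, ← hu] at h2
    have h3 := norm_comm_total_le hA hAb (by linarith) hO
    -- The bound `δ ≤ 6` lets the same `b` serve for potentials and for local operators.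
    have h4 : 2 * a ≤ r := by
      rw [hra, le_div_iff₀ hδ]; nlinarith
    calc ‖u * Y * O * star (u * Y) - O‖
        = ‖u * (Y * O * star Y - O) * star u + (u * O * star u - O)‖ := by
          rw [hsub]; congr 1; noncomm_ring
      _ ≤ ‖Y * O * star Y - O‖ + ‖u * O * star u - O‖ := by
          refine (norm_add_le _ _).trans ?_
          rw [norm_unitary_conj huu]
      _ ≤ b * S.card * ‖O‖ + 2 * a * S.card * ‖O‖ := add_le_add h1 (h2.trans h3)
      _ ≤ b * S.card * ‖O‖ + (r * (1 + b)) * S.card * ‖O‖ := by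
          have h5 : 2 * a ≤ r * (1 + b) := by nlinarith
          have h6 := mul_le_mul_of_nonneg_right h5 (show 0 ≤ (S.card : ℝ) * ‖O‖ by positivity)
          linarith
      _ = _ := by ring

end Step

/-! ### Iteration and drift of the charges -/

section Iteration

variable {Λ : Type*} [Fintype Λ] [DecidableEq Λ] {d q : ℕ}
  {𝒢 : SimpleGraph Λ} {R : ℕ} {γ : ℝ} {N : Fin q → Finset Λ → Op Λ d}

theorem IsFrame.mono {J : EuclideanSpace ℝ (Fin q)} {H Y : Op Λ d} {D V : Finset Λ → Op Λ d}
    {κ₁ κ dB v b κ' dB' v' b' : ℝ} (hF : IsFrame 𝒢 N J H κ₁ κ dB v b Y D V) (hκ : κ' ≤ κ)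
    (hdB : dB ≤ dB') (hv : v ≤ v') (hb : b ≤ b') :
    IsFrame 𝒢 N J H κ₁ κ' dB' v' b' Y D V where
  mem_unitary := hF.mem_unitary
  potD := hF.potD
  selfAdjointD := hF.selfAdjointD
  potV := hF.potV
  selfAdjointV := hF.selfAdjointV
  conj_eq := hF.conj_eq
  commute := hF.commute
  boundD := hF.boundD.mono hκ hdB
  boundV := hF.boundV.mono hκ hv
  conj_potential G B hG hB hGB := by
    obtain ⟨K, hK, hKe, hKb⟩ := hF.conj_potential G B hG hB hGB
    exact ⟨K, hK, hKe, hKb.mono hκ (by gcongr)⟩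
  conj_local S O hO := (hF.conj_local S O hO).trans (by gcongr)

/-- The frame of the original Hamiltonian. -/
theorem isFrame_one {J : EuclideanSpace ℝ (Fin q)} {H : Op Λ d} {V : Finset Λ → Op Λ d}
    {κ v : ℝ} (hV : IsPotential 𝒢 N V) (hVs : ∀ S, IsSelfAdjoint (V S)) (hVb : LocBound κ V v)
    (hH : H = freeHamiltonian J N + total V) : IsFrame 𝒢 N J H κ κ 0 v 0 1 0 V where
  mem_unitary := one_mem _
  potD := isPotential_zero
  selfAdjointD _ := IsSelfAdjoint.zero _
  potV := hV
  selfAdjointV := hVs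
  conj_eq := by simp [hH]
  commute α := by simp
  boundD := locBound_zero κ
  boundV := hVb
  conj_potential G B hG hB hGB := ⟨0, isPotential_zero, by simp, by
    rw [zero_mul]; exact locBound_zero κ⟩
  conj_local S O hO := by simp

/-- Repeated steps with the same loss of rate halve the remainder each time. -/
theorem IsFrame.iterate (hN : IsChargeFamily 𝒢 R γ N) {J : EuclideanSpace ℝ (Fin q)}
    (hJ : ∀ m, intDot J m = 0 → m = 0) {Q p C : ℝ} (hQ0 : 0 ≤ Q)
    (hQ : ∀ s : ℕ, 1 ≤ s → ∃ M : ℕ, 2 * ((s : ℝ) * γ) ≤ M ∧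
      ∑ m ∈ box q M, |(intDot J m)⁻¹| ≤ Q * (s : ℝ) ^ (p - 1))
    (hC : ∀ y : ℝ, 0 < y → y ^ (p - 1) ≤ C * Real.exp y) (hC0 : 0 ≤ C)
    {H Y : Op Λ d} {D V : Finset Λ → Op Λ d} {κ₁ κ dB v b δ c₀ : ℝ}
    (hF : IsFrame 𝒢 N J H κ₁ κ dB v b Y D V) (hκ₁ : κ ≤ κ₁) (hδ : 0 < δ) (hδ6 : δ ≤ 6)
    (hdB : 0 ≤ dB) (hv : 0 ≤ v) (hb : 0 ≤ b) (hc₀ : c₀ = 12 * (Q * C * δ ^ (-p)))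
    (hsmall : c₀ * (dB + 5 * v) ≤ 1 / 2) (hb1 : b + 4 * (c₀ * v) ≤ 1) (n : ℕ)
    (hn : 2 * (n * δ) ≤ κ) :
    ∃ (Y' : Op Λ d) (D' V' : Finset Λ → Op Λ d), IsFrame 𝒢 N J H κ₁ (κ - 2 * (n * δ))
      (dB + 2 * v * (1 - (1 / 2) ^ n)) (v * (1 / 2) ^ n)
      (b + 4 * (c₀ * v) * (1 - (1 / 2) ^ n)) Y' D' V' := by
  have hc0 : 0 ≤ c₀ := by rw [hc₀]; positivity
  induction n with
  | zero => exact ⟨Y, D, V, by simpa using hF⟩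
  | succ n ih =>
    push_cast at hn
    obtain ⟨Y', D', V', hF'⟩ := ih (by linarith)
    set h : ℝ := (1 / 2) ^ n with hh
    have hh0 : 0 < h := by positivity
    have hh1 : h ≤ 1 := pow_le_one₀ (by norm_num) (by norm_num)
    have hcv : 0 ≤ c₀ * v := by positivity
    have hcv1 : c₀ * v ≤ 1 / 4 := by linarith
    have hnδ : (0 : ℝ) ≤ n * δ := by positivity
    -- The increments of the two bounds, `v h` and at most `2 c₀ v h`, are geometric. Their sums
    -- stay below `2v` and `4 c₀ v`, so the smallness conditions persist.
    obtain ⟨Y'', D'', V'', hF''⟩ := hF'.step (r := c₀ * v * h) hN hJ hQ0 hQ hC hC0 (by linarith) hδ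
      hδ6 (by linarith) (by nlinarith [mul_nonneg hv (sub_nonneg.2 hh1)]) (by positivity)
      (by nlinarith [mul_nonneg hcv (sub_nonneg.2 hh1)]) (by rw [hc₀]; ring) (by nlinarith)
    have hp : ((1 : ℝ) / 2) ^ (n + 1) = h / 2 := by rw [pow_succ, hh]; ring
    refine ⟨Y'', D'', V'', hF''.mono ?_ ?_ ?_ ?_⟩
    · push_cast; linarith
    · rw [hp]; linarith
    · rw [hp]
      have h1 : dB + 2 * v * (1 - h) + 3 * (v * h) ≤ dB + 5 * v := by nlinarith
      calc c₀ * v * h * (dB + 2 * v * (1 - h) + 3 * (v * h))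
          ≤ c₀ * v * h * (dB + 5 * v) := by gcongr
        _ = v * h * (c₀ * (dB + 5 * v)) := by ring
        _ ≤ v * h * (1 / 2) := by gcongr
        _ = _ := by ring
    · rw [hp]
      have h1 : b + 4 * (c₀ * v) * (1 - h) ≤ 1 := by nlinarith
      have h2 : c₀ * v * h * (1 + (b + 4 * (c₀ * v) * (1 - h))) ≤ c₀ * v * h * 2 := by
        gcongr; linarith
      linarith

theorem commute_total_charges (hN : IsChargeFamily 𝒢 R γ N) (α β : Fin q) :
    Commute (total (N α)) (total (N β)) :=
  Commute.sum_left _ _ _ fun S _ => Commute.sum_right _ _ _ fun T _ => hN.commute α β S T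

theorem commute_freeHamiltonian (hN : IsChargeFamily 𝒢 R γ N) (J : EuclideanSpace ℝ (Fin q))
    (α : Fin q) : Commute (freeHamiltonian J N) (total (N α)) :=
  Commute.sum_left _ _ _ fun β _ => (commute_total_charges hN β α).smul_left _

theorem isSelfAdjoint_freeHamiltonian (hN : IsChargeFamily 𝒢 R γ N)
    (J : EuclideanSpace ℝ (Fin q)) : IsSelfAdjoint (freeHamiltonian J N) := by
  rw [freeHamiltonian, isSelfAdjoint_iff, star_sum]
  refine Finset.sum_congr rfl fun α _ => ?_
  rw [star_smul, (isSelfAdjoint_total (hN.selfAdjoint α)).star_eq]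
  simp

/-- The term at `S` meets a charge of norm at most `γ' |S|`; distributing `|S|` over its sites gives
an extensive bound. -/
theorem norm_comm_total_charge_le (hN : IsChargeFamily 𝒢 R γ N) {V : Finset Λ → Op Λ d}
    {κ v γ' : ℝ} (hV : IsPotential 𝒢 N V) (hVb : LocBound κ V v) (hκ : 0 ≤ κ) (hγ : γ ≤ γ')
    (hγ' : 0 ≤ γ') (α : Fin q) :
    ‖comm (total V) (total (N α))‖ ≤ Fintype.card Λ * (2 * γ' * v) := by
  have hV0 := hVb.mono hκ le_rfl
  have h1 : ∀ S, ‖comm (V S) (total (N α))‖ ≤ ∑ i : Λ, if i ∈ S then 2 * γ' * ‖V S‖ else 0 := by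
    intro S
    rw [comm_total_charge hN (hV.mem S) α, Finset.sum_ite_mem, Finset.univ_inter,
      Finset.sum_const, nsmul_eq_mul]
    refine (norm_comm_le _ _).trans ?_
    have h2 : ‖innerCharge N α S‖ ≤ S.card * γ' :=
      ((norm_sum_le _ _).trans (sum_norm_charge_le hN α S)).trans (by gcongr)
    calc 2 * ‖V S‖ * ‖innerCharge N α S‖ ≤ 2 * ‖V S‖ * (S.card * γ') := by gcongr
      _ = _ := by ring
  rw [total, comm_sum_left]
  calc ‖∑ S, comm (V S) (total (N α))‖ ≤
        ∑ S : Finset Λ, ∑ i : Λ, if i ∈ S then 2 * γ' * ‖V S‖ else 0 :=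
        (norm_sum_le _ _).trans (Finset.sum_le_sum fun S _ => h1 S)
    _ = ∑ i : Λ, 2 * γ' * ∑ S : Finset Λ with i ∈ S, ‖V S‖ := by
        rw [Finset.sum_comm]
        refine Finset.sum_congr rfl fun i _ => ?_
        rw [Finset.mul_sum, Finset.sum_filter]
    _ ≤ ∑ _i : Λ, 2 * γ' * v := by
        refine Finset.sum_le_sum fun i _ => ?_
        gcongr
        simpa using hV0 i
    _ = _ := by simp

/-- The dressed charges move at a rate bounded by the remainder. -/
theorem IsFrame.heisenberg_sub_le (hN : IsChargeFamily 𝒢 R γ N) {J : EuclideanSpace ℝ (Fin q)}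
    {H Y : Op Λ d} {D V : Finset Λ → Op Λ d} {κ₁ κ dB v b γ' : ℝ}
    (hF : IsFrame 𝒢 N J H κ₁ κ dB v b Y D V) (hH : IsSelfAdjoint H) (hκ : 0 ≤ κ) (hv : 0 ≤ v)
    (hγ : γ ≤ γ') (hγ' : 0 ≤ γ') (α : Fin q) (t : ℝ) :
    1 / (Fintype.card Λ : ℝ) *
      ‖heisenberg H t (star Y * total (N α) * Y) - star Y * total (N α) * Y‖ ≤
        |t| * (2 * γ' * v) := by
  set a : Op Λ d := (Complex.I * (t : ℂ)) • H with ha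
  have has : star a = -a := by
    rw [ha, star_smul, hH.star_eq, ← neg_smul]
    congr 1
    simp
  have hY1 : star Y * Y = 1 := (Unitary.mem_iff.1 hF.mem_unitary).1
  have h1 := norm_exp_conj_sub_le has (star Y * total (N α) * Y)
  have h2 : comm a (star Y * total (N α) * Y) =
      (Complex.I * (t : ℂ)) • (star Y * comm (total V) (total (N α)) * Y) := by
    -- In the rotated frame `H⁰` and `D` conserve the charge, so only `V` contributes.
    have h3 : comm (total V) (total (N α)) = comm (Y * H * star Y) (total (N α)) := by
      have h4 := (commute_freeHamiltonian hN J α).eq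
      have h5 := (hF.commute α).eq
      rw [hF.conj_eq, comm, comm, add_mul, add_mul, mul_add, mul_add, h4, h5]
      abel
    have h6 : star Y * comm (Y * H * star Y) (total (N α)) * Y =
        comm H (star Y * total (N α) * Y) := by
      calc _ = (star Y * Y) * H * (star Y * total (N α) * Y) -
            (star Y * total (N α) * Y) * H * (star Y * Y) := by simp only [comm]; noncomm_ring
        _ = _ := by rw [hY1]; simp [comm]
    rw [h3, h6, ha]
    simp [comm, smul_sub]
  have h7 : ‖star Y * comm (total V) (total (N α)) * Y‖ = ‖comm (total V) (total (N α))‖ := by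
    have := norm_unitary_conj (Unitary.star_mem hF.mem_unitary) (comm (total V) (total (N α)))
    rwa [star_star] at this
  rw [h2, norm_smul, h7] at h1
  have h8 : ‖Complex.I * (t : ℂ)‖ = |t| := by simp
  rw [h8] at h1
  have h9 := norm_comm_total_charge_le hN hF.potV hF.boundV hκ hγ hγ' α
  have h10 : ‖heisenberg H t (star Y * total (N α) * Y) - star Y * total (N α) * Y‖ ≤
      |t| * (Fintype.card Λ * (2 * γ' * v)) := h1.trans (by gcongr)
  rcases Nat.eq_zero_or_pos (Fintype.card Λ) with h0 | h0
  · rw [h0]; simp; positivity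
  · have : (0 : ℝ) < Fintype.card Λ := by exact_mod_cast h0
    rw [one_div, inv_mul_le_iff₀ this]
    linarith

/-- The frame after the first step and `n` further steps. -/
theorem exists_isFrame (hN : IsChargeFamily 𝒢 R γ N) {J : EuclideanSpace ℝ (Fin q)}
    (hJ : ∀ m, intDot J m = 0 → m = 0) {Q p C : ℝ} (hQ0 : 0 ≤ Q)
    (hQ : ∀ s : ℕ, 1 ≤ s → ∃ M : ℕ, 2 * ((s : ℝ) * γ) ≤ M ∧
      ∑ m ∈ box q M, |(intDot J m)⁻¹| ≤ Q * (s : ℝ) ^ (p - 1))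
    (hC : ∀ y : ℝ, 0 < y → y ^ (p - 1) ≤ C * Real.exp y) (hC0 : 0 ≤ C)
    {H : Op Λ d} {V : Finset Λ → Op Λ d} {κ₁ g e : ℝ} (hκ₁ : 0 < κ₁) (hκ₁' : κ₁ ≤ 1) (hg : 0 < g)
    (hV : IsPotential 𝒢 N V) (hVs : ∀ S, IsSelfAdjoint (V S)) (hVb : LocBound κ₁ V g)
    (hH : H = freeHamiltonian J N + total V)
    (he : 12 * (Q * C * (κ₁ / 8) ^ (-p) * g) ≤ e) (he1 : 3 * e ≤ 1) (n : ℕ) (hn : 1 ≤ n)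
    (hδ : 144 * (Q * C * (κ₁ / (8 * n)) ^ (-p) * g) ≤ 1) :
    ∃ (Y : Op Λ d) (D' V' : Finset Λ → Op Λ d),
      IsFrame 𝒢 N J H κ₁ (κ₁ / 2) (3 * g) (g * (1 / 2) ^ n) (2 * e) Y D' V' := by
  have hn' : (1 : ℝ) ≤ n := by exact_mod_cast hn
  have he0 : 0 ≤ e := le_trans (by positivity) he
  -- A fixed loss of rate gains the full factor `e`. Without this step, the later rotations would be
  -- controlled only by `c₀ g`, which is of order one.
  obtain ⟨Y, D, V₁, hF⟩ := (isFrame_one (J := J) hV hVs hVb hH).step hN hJ hQ0 hQ hC hC0 le_rfl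
    (show 0 < κ₁ / 8 by positivity) (by linarith) (by linarith) le_rfl hg.le le_rfl rfl
    (he.trans (by linarith))
  have hF' : IsFrame 𝒢 N J H κ₁ (3 * κ₁ / 4) g (3 * e * g) e Y D V₁ := by
    refine hF.mono (by linarith) (by linarith) ?_ (by linarith)
    calc _ ≤ e * (0 + 3 * g) := by gcongr
      _ = _ := by ring
  -- The `n` further steps use up `2nδ = κ₁/4` of the rate, leaving `κ₁/2`.
  set δ := κ₁ / (8 * n) with hδd
  have hδ0 : 0 < δ := by positivity
  have hnδ : n * δ = κ₁ / 8 := by rw [hδd]; field_simp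
  have hδ6 : δ ≤ 6 := by
    have : δ ≤ n * δ := by nlinarith
    linarith
  set c₀ := 12 * (Q * C * δ ^ (-p)) with hc₀
  have hc0 : 0 ≤ c₀ := by positivity
  have hcg : c₀ * g ≤ 1 / 12 := by
    have : 12 * (c₀ * g) = 144 * (Q * C * δ ^ (-p) * g) := by rw [hc₀]; ring
    linarith
  have hcv : c₀ * (3 * e * g) ≤ e / 4 := by
    calc c₀ * (3 * e * g) = (c₀ * g) * (3 * e) := by ring
      _ ≤ 1 / 12 * (3 * e) := by gcongr
      _ = _ := by ring
  have hvg : 3 * e * g ≤ g := by nlinarith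
  obtain ⟨Y', D', V', hF''⟩ := hF'.iterate hN hJ hQ0 hQ hC hC0 (by linarith) hδ0 hδ6 hg.le
    (by positivity) he0 hc₀ (by
      calc c₀ * (g + 5 * (3 * e * g)) ≤ c₀ * (g + 5 * g) := by gcongr
        _ = 6 * (c₀ * g) := by ring
        _ ≤ _ := by linarith) (by linarith) n (by linarith)
  have hp0 : (0 : ℝ) < (1 / 2) ^ n := by positivity
  have hp1 : ((1 : ℝ) / 2) ^ n ≤ 1 := pow_le_one₀ (by norm_num) (by norm_num)
  refine ⟨Y', D', V', hF''.mono (by linarith) ?_ (by gcongr) ?_⟩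
  · have : 0 ≤ 3 * e * g := by positivity
    nlinarith
  · have : 0 ≤ c₀ * (3 * e * g) := by positivity
    nlinarith

end Iteration

end SpinSystem

/-! ### Choice of constants and the main theorem -/

open SpinSystem in
theorem theorem1 (κ₀ γ p : ℝ) (q : ℕ) (hκ₀ : 0 < κ₀) :
    ∃ c C ε₀ : ℝ, 0 < c ∧ 0 < C ∧ 0 < ε₀ ∧
      ∀ (Λ : Type*) [Fintype Λ] [DecidableEq Λ] (𝒢 : SimpleGraph Λ) (d R : ℕ)
        (N : Fin q → Finset Λ → Op Λ d) (J : EuclideanSpace ℝ (Fin q))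
        (W : Finset Λ → Op Λ d) (g x τ : ℝ),
        IsChargeFamily 𝒢 R γ N →
        J ≠ 0 → 0 < x → 0 < τ → Diophantine J x τ → (q : ℝ) + τ < p →
        IsPotential 𝒢 N W → (∀ S, IsSelfAdjoint (W S)) →
        0 < g → localNorm 𝒢 κ₀ ((g : ℂ) • W) ≤ g →
        ∀ (ε κ : ℝ) (H : Op Λ d),
        ε = smallParameter g J x → κ = decayRate c κ₀ ε →
        H = freeHamiltonian J N + total ((g : ℂ) • W) →
        ε ≤ ε₀ →
        ∃ (Y : Op Λ d) (D V : Finset Λ → Op Λ d),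
          Y ∈ unitary (Op Λ d) ∧
          IsPotential 𝒢 N D ∧ (∀ S, IsSelfAdjoint (D S)) ∧
          IsPotential 𝒢 N V ∧ (∀ S, IsSelfAdjoint (V S)) ∧
          -- the Hamiltonian in the rotated frame
          Y * H * star Y = freeHamiltonian J N + total D + total V ∧
          (∀ α, Commute (total (N α)) (total D)) ∧
          localNorm 𝒢 κ D ≤ C * g ∧
          localNorm 𝒢 κ V ≤ g * Real.exp (-c * (1 / ε) ^ (1 / p)) ∧
          -- the conjugation by `Y` is quasi-local and close to the identity
          (∀ G : Finset Λ → Op Λ d, IsPotential 𝒢 N G →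
            ∃ K : Finset Λ → Op Λ d, IsPotential 𝒢 N K ∧
              total K = Y * total G * star Y - total G ∧
              localNorm 𝒢 κ K ≤ C * ε * localNorm 𝒢 κ₀ G) ∧
          (∀ (S : Finset Λ) (O : Op Λ d), SupportedIn S O →
            ‖Y * O * star Y - O‖ ≤ C * ε * (S.card : ℝ) * ‖O‖) ∧
          -- the dressed charges are quasi-conserved
          (∀ (α : Fin q) (t : ℝ), |t| ≤ Real.exp (c * (1 / ε) ^ (1 / p)) →
            1 / (Fintype.card Λ : ℝ) *
                ‖heisenberg H t (star Y * total (N α) * Y) - star Y * total (N α) * Y‖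
              ≤ g * Real.exp (-c * (1 / ε) ^ (1 / p))) ∧
          (∀ (α : Fin q) (t : ℝ), |t| ≤ c / g * Real.exp (c * (1 / ε) ^ (1 / p)) →
            1 / (Fintype.card Λ : ℝ) *
                ‖heisenberg H t (star Y * total (N α) * Y) - star Y * total (N α) * Y‖
              ≤ C * Real.exp (-c * (1 / ε) ^ (1 / p))) := by
  by_cases hp1 : 1 < p
  swap
  · refine ⟨1, 1, 1, one_pos, one_pos, one_pos, ?_⟩
    intro Λ _ _ 𝒢 d R N J W g x τ _ hJ _ hτ hD hp
    exact absurd (hD.exists_exponent hJ hτ hp).1 hp1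
  obtain ⟨Γ, hΓ, hdiv⟩ := exists_divisor_bound γ p q
  have hp0 : 0 < p := by linarith
  set A : ℝ := (⌈p - 1⌉₊.factorial : ℝ) with hA
  have hA0 : 0 < A := by positivity
  set P := Γ * A with hP
  have hP0 : 0 < P := by positivity
  -- Capping the rate at `1` keeps every loss `δ` below the `6` required by the step.
  set κ₁ := min κ₀ 1 with hκ₁
  have hκ₁0 : 0 < κ₁ := lt_min hκ₀ one_pos
  have hκ₁1 : κ₁ ≤ 1 := min_le_right _ _
  have hκ₁κ : κ₁ ≤ κ₀ := min_le_left _ _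
  set γ' := max γ 0 with hγ'
  have hγ0 : 0 ≤ γ' := le_max_right _ _
  have hγγ : γ ≤ γ' := le_max_left _ _
  set E₁ := 12 * P * (κ₁ / 8) ^ (-p) with hE₁
  have hE₁0 : 0 < E₁ := by positivity
  -- Chosen so that `144 P ε (κ₁ / (8 c₁ E))^(-p) = 1`, where `E = (1/ε)^(1/p)`: then `n = ⌊c₁ E⌋`
  -- halving steps are allowed.
  set c₁ := κ₁ / 8 * (144 * P) ^ (-(1 / p)) with hc₁
  have hc₁0 : 0 < c₁ := by positivity
  -- The first bound gives `cE + c₁E/8 - c₁E/4 ≤ -cE` for the drift; the second gives `κ ≤ κ₁/2`.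
  set c := min (c₁ / 16) (κ₁ / (2 * κ₀)) with hc
  have hc0 : 0 < c := lt_min (by positivity) (by positivity)
  have hcc₁ : c ≤ c₁ / 16 := min_le_left _ _
  -- For `E ≥ E₀` there is at least one halving step, and `2γ' ≤ exp(c₁E/8)`.
  set E₀ := (16 * γ' + 2) / c₁ with hE₀
  have hE₀0 : 0 < E₀ := by positivity
  -- The summands of `C` serve `D`, the closeness of `Y` to the identity and the long-time drift.
  -- The bounds on `ε` ensure `|log ε| ≥ 1`, a small first step and `E ≥ E₀`.
  refine ⟨c, 3 + 2 * E₁ + 2 * γ' * c, min (Real.exp (-1)) (min (1 / (3 * E₁)) (E₀ ^ (-p))), hc0,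
    by positivity, lt_min (Real.exp_pos _) (lt_min (by positivity) (by positivity)), ?_⟩
  intro Λ _ _ 𝒢 d R N J W g x τ hN hJ hx hτ hD hp hW hWs hg hWb ε κ H hε hκ hH hεε
  have hJ0 : 0 < ‖J‖ := norm_pos_iff.2 hJ
  have hε0 : 0 < ε := by rw [hε, smallParameter]; positivity
  have hε1 : ε ≤ Real.exp (-1) := hεε.trans (min_le_left _ _)
  have hε2 : ε ≤ 1 / (3 * E₁) := hεε.trans ((min_le_right _ _).trans (min_le_left _ _))
  have hε3 : ε ≤ E₀ ^ (-p) := hεε.trans ((min_le_right _ _).trans (min_le_right _ _))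
  set E := (1 / ε) ^ (1 / p) with hE
  have hE0 : 0 < E := by positivity
  have hEp : E ^ p = 1 / ε := by
    rw [hE, ← Real.rpow_mul (by positivity), one_div_mul_cancel hp0.ne', Real.rpow_one]
  have hEE : E₀ ≤ E := by
    rw [← Real.rpow_le_rpow_iff hE₀0.le hE0.le hp0, hEp]
    rw [Real.rpow_neg hE₀0.le] at hε3
    rw [le_div_iff₀ hε0]
    have := mul_le_mul_of_nonneg_left hε3 (show 0 ≤ E₀ ^ p by positivity)
    rwa [mul_inv_cancel₀ (by positivity)] at this
  have hcE : 16 * γ' + 2 ≤ c₁ * E := by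
    rw [hE₀, div_le_iff₀ hc₁0] at hEE; linarith
  set n := ⌊c₁ * E⌋₊ with hn
  have hn1 : 1 ≤ n := by
    rw [hn, Nat.one_le_floor_iff]; linarith
  have hnR : (1 : ℝ) ≤ n := by exact_mod_cast hn1
  have hnle : (n : ℝ) ≤ c₁ * E := Nat.floor_le (by positivity)
  have hnge : c₁ * E / 2 ≤ n := by
    have := Nat.lt_floor_add_one (c₁ * E)
    rw [← hn] at this
    linarith
  set Q := Γ / (x * ‖J‖) with hQ
  have hQ0 : 0 ≤ Q := by positivity
  have hQg : Q * A * g ≤ P * ε := by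
    have h1 : g / (x * ‖J‖) ≤ ε := by
      rw [hε, smallParameter]
      have : g / ‖J‖ * (1 + 1 / x) = g / ‖J‖ + g / (x * ‖J‖) := by field_simp
      rw [this]
      have : 0 < g / ‖J‖ := by positivity
      linarith
    calc Q * A * g = P * (g / (x * ‖J‖)) := by rw [hQ, hP]; ring
      _ ≤ _ := by gcongr
  have hJm : ∀ m, intDot J m = 0 → m = 0 := by
    intro m hm
    by_contra hne
    have h1 := hD m hne
    have h2 : ∑ α, (m α : ℝ) * J α = 0 := hm
    rw [h2, abs_zero] at h1
    have h3 : 0 < ‖WithLp.toLp 2 (fun α => (m α : ℝ))‖ := by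
      rw [norm_pos_iff]
      intro h0
      apply hne
      funext α
      simpa using congrArg (fun v : EuclideanSpace ℝ (Fin q) => v α) h0
    have : 0 < x * ‖J‖ / ‖WithLp.toLp 2 (fun α => (m α : ℝ))‖ ^ τ := by positivity
    linarith
  have hV : IsPotential 𝒢 N ((g : ℂ) • W) := hW.smul _
  have hVs : ∀ S, IsSelfAdjoint (((g : ℂ) • W) S) := fun S => by
    rw [Pi.smul_apply, isSelfAdjoint_iff, star_smul, (hWs S).star_eq]; simp
  have hVb : LocBound κ₁ ((g : ℂ) • W) g := (locBound_localNorm hV κ₀).mono hκ₁κ hWb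
  have hδ : 144 * (Q * A * (κ₁ / (8 * n)) ^ (-p) * g) ≤ 1 := by
    have h1 : (κ₁ / (8 * n)) ^ (-p) ≤ (κ₁ / (8 * (c₁ * E))) ^ (-p) :=
      Real.rpow_le_rpow_of_nonpos (by positivity) (by gcongr) (by linarith)
    have h2 : κ₁ / (8 * (c₁ * E)) = (144 * P) ^ (1 / p) * E⁻¹ := by
      rw [hc₁, Real.rpow_neg (by positivity)]; field_simp
    have h3 : (κ₁ / (8 * (c₁ * E))) ^ (-p) = (144 * P)⁻¹ * (1 / ε) := by
      rw [h2, Real.mul_rpow (by positivity) (by positivity), ← Real.rpow_mul (by positivity),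
        Real.inv_rpow hE0.le, Real.rpow_neg hE0.le, inv_inv, hEp]
      congr 1
      rw [mul_neg, one_div_mul_cancel hp0.ne', Real.rpow_neg_one]
    calc 144 * (Q * A * (κ₁ / (8 * n)) ^ (-p) * g)
        = 144 * (Q * A * g) * (κ₁ / (8 * n)) ^ (-p) := by ring
      _ ≤ 144 * (P * ε) * ((144 * P)⁻¹ * (1 / ε)) := by rw [← h3]; gcongr
      _ = 1 := by field_simp
  obtain ⟨Y, D, V, hF⟩ := exists_isFrame (e := E₁ * ε) hN hJm hQ0
    (hdiv J x τ hJ hx hτ hD hp)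
    (fun y hy => rpow_le_factorial_mul_exp (show 0 ≤ p - 1 by linarith) hy) hA0.le hκ₁0 hκ₁1 hg
    hV hVs hVb hH (by
      calc 12 * (Q * A * (κ₁ / 8) ^ (-p) * g) = 12 * (Q * A * g) * (κ₁ / 8) ^ (-p) := by ring
        _ ≤ 12 * (P * ε) * (κ₁ / 8) ^ (-p) := by gcongr
        _ = _ := by rw [hE₁]; ring) (by
      rw [le_div_iff₀ (by positivity)] at hε2; linarith) n hn1 hδ
  have hlog : 1 ≤ |Real.log ε| := by
    have h1 : Real.log ε ≤ -1 := by
      rw [← Real.log_exp (-1)]; exact Real.log_le_log hε0 hε1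
    rw [abs_of_nonpos (by linarith)]; linarith
  -- The frame has a rate independent of `ε`; the logarithm in `κ` only weakens it.
  have hκle : κ ≤ κ₁ / 2 := by
    rw [hκ, decayRate]
    calc c * κ₀ * |Real.log ε|⁻¹ ≤ c * κ₀ * 1 := by
          gcongr
          exact inv_le_one_of_one_le₀ hlog
      _ ≤ κ₁ / (2 * κ₀) * κ₀ * 1 := by
          gcongr
          exact min_le_right _ _
      _ = κ₁ / 2 := by field_simp
  -- Uses `n ≥ c₁E/2` and `log 2 ≥ 1/2`.
  have hhalf : ((1 : ℝ) / 2) ^ n ≤ Real.exp (-(c₁ * E / 4)) := by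
    have h1 : ((1 : ℝ) / 2) ^ n = Real.exp (-(n * Real.log 2)) := by
      rw [Real.exp_neg, mul_comm, Real.exp_mul, Real.exp_log (by norm_num), Real.rpow_natCast]
      simp
    have h2 : (n : ℝ) * (1 / 2) ≤ n * Real.log 2 := by
      gcongr
      linarith [Real.log_two_gt_d9]
    rw [h1]
    gcongr
    linarith
  have hcE' : c * E ≤ c₁ / 16 * E := by gcongr
  have hVfin : g * (1 / 2) ^ n ≤ g * Real.exp (-c * E) := by
    gcongr
    refine hhalf.trans ?_
    gcongr
    linarith
  have hHs : IsSelfAdjoint H := by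
    rw [hH]; exact (isSelfAdjoint_freeHamiltonian hN J).add (isSelfAdjoint_total hVs)
  have hCE : 2 * (E₁ * ε) ≤ (3 + 2 * E₁ + 2 * γ' * c) * ε := by
    have : 0 ≤ (3 + 2 * γ' * c) * ε := by positivity
    linarith
  refine ⟨Y, D, V, hF.mem_unitary, hF.potD, hF.selfAdjointD, hF.potV, hF.selfAdjointV, hF.conj_eq,
    hF.commute, ?_, ?_, ?_, ?_, ?_, ?_⟩
  · refine (hF.boundD.mono hκle ?_).localNorm_le (by positivity)
    have : 0 ≤ (2 * E₁ + 2 * γ' * c) * g := by positivity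
    linarith
  · exact (hF.boundV.mono hκle hVfin).localNorm_le (by positivity)
  · intro G hG
    have hG0 : 0 ≤ localNorm 𝒢 κ₀ G := by
      refine Real.iSup_nonneg fun i => Finset.sum_nonneg fun S _ => by positivity
    obtain ⟨K, hK, hKe, hKb⟩ := hF.conj_potential G _ hG hG0
      ((locBound_localNorm hG κ₀).mono hκ₁κ le_rfl)
    refine ⟨K, hK, hKe, (hKb.mono hκle ?_).localNorm_le (by positivity)⟩
    gcongr
  · intro S O hO
    refine (hF.conj_local S O hO).trans ?_
    gcongr
  · intro α t ht
    refine (hF.heisenberg_sub_le hN hHs (by positivity) (by positivity) hγγ hγ0 α t).trans ?_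
    -- Half of the decay `exp(-c₁E/4)` absorbs the factor `2γ'`; the other half pays for the time
    -- and for the final bound.
    have h1 : 2 * γ' ≤ Real.exp (c₁ * E / 8) := by
      have := Real.add_one_le_exp (c₁ * E / 8)
      linarith
    calc |t| * (2 * γ' * (g * (1 / 2) ^ n))
        ≤ Real.exp (c * E) * (Real.exp (c₁ * E / 8) * (g * Real.exp (-(c₁ * E / 4)))) := by gcongr
      _ = g * Real.exp (c * E + c₁ * E / 8 + -(c₁ * E / 4)) := by
          rw [Real.exp_add, Real.exp_add]; ring
      _ ≤ _ := by
          gcongr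
          linarith
  · intro α t ht
    refine (hF.heisenberg_sub_le hN hHs (by positivity) (by positivity) hγγ hγ0 α t).trans ?_
    calc |t| * (2 * γ' * (g * (1 / 2) ^ n))
        ≤ (c / g * Real.exp (c * E)) * (2 * γ' * (g * Real.exp (-(c₁ * E / 4)))) := by gcongr
      _ = 2 * γ' * c * Real.exp (c * E + -(c₁ * E / 4)) := by
          rw [Real.exp_add]; field_simp
      _ ≤ (3 + 2 * E₁ + 2 * γ' * c) * Real.exp (-c * E) := by
          gcongr
          · linarith
          · linarith
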